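/- Let $\mathfrak A$ be a finite-dimensional (unital) $C^*$-algebra. A state is a linear functional $\omega:\mathfrak A\to\mathbb C$ with $\omega(A^*A)\ge 0$ for all $A$ and $\omega(\mathbb I)=\|\omega\|=1$; pure states are the extreme points of the convex set of states. For a probability vector $q$ let $\mathrm H(q)=-\sum_k q_k\log q_k$ (with $0\log 0=0$), for a density matrix $\rho$ (a positive operator of trace one) let $\mathcal S_{\mathrm{VN}}(\rho)=-\operatorname{Tr}(\rho\log\rho)$, and for a state $\omega$ let $$\mathcal S(\omega)=\inf\Big\{\mathrm H(q)\;:\;\omega=\sum_k q_k\omega_k \text{ (finite sum)},\ q\text{ a probability vector},\ \omega_k\text{ pure states}\Big\}.$$ Let $(\mathcal H,\pi)$ be a faithful non-degenerate finite-dimensional $*$-representation of $\mathfrak A$, decomposed (up to a unitary transformation) into irreducible representations, $$(\mathcal H,\pi)=\bigoplus_{i=1}^N\big(\mathcal H_i\otimes\mathbb C^{m_i},\ \pi_i\otimes\mathbb I_{m_i}\big),$$ with $(\mathcal H_i,\pi_i)$ irreducible and pairwise inequivalent and multiplicities $m_i\ge 1$. Then the following hold. For every state $\omega$ there is a unique density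 matrix $\rho_\omega\in\pi(\mathfrak A)$ with $\omega(A)=\operatorname{Tr}(\rho_\omega\pi(A))$ for all $A\in\mathfrak A$. It can be written as $$\rho_\omega=\bigoplus_{i=1}^N p_i\Big(\rho_i\otimes\frac{\mathbb I_{m_i}}{m_i}\Big)$$ with a probability vector $p=(p_1,\dots,p_N)$ and density matrices $\rho_i$ on $\mathcal H_i$, and for every such way of writing it: 1. $\displaystyle \mathcal S(\omega)=\mathrm H(p)+\sum_i p_i\,\mathcal S_{\mathrm{VN}}(\rho_i)$. 2. The infimum is attained by the combined spectral decomposition: if $\rho_i=\sum_j\lambda^{(i)}_j|\psi^{(i)}_j\rangle\langle\psi^{(i)}_j|$ with $(\psi^{(i)}_j)_j$ orthonormal for each $i$, then $(p_i\lambda^{(i)}_j)_{i,j}$ is a probability vector, the operators $\rho^{(i)}_j=0\oplus\dots\oplus\big(|\psi^{(i)}_j\rangle\langle\psi^{(i)}_j|\otimes\mathbb I_{m_i}/m_i\big)\oplus\dots\oplus 0$ are the density matrices in $\pi(\mathfrak A)$ of pure states $\omega^{(i)}_j$, one has $\omega=\sum_{i,j}p_i\lambda^{(i)}_j\,\omega^{(i)}_j$,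 and $\mathrm H\big((p_i\lambda^{(i)}_j)_{i,j}\big)$ is the minimum of the Shannon entropies of all decompositions of $\omega$ into pure states. 3. $\displaystyle \mathcal S_{\mathrm{VN}}(\rho_\omega)=\mathcal S(\omega)+\sum_i p_i\log m_i$. In particular $\mathcal S_{\mathrm{VN}}(\rho_\omega)=\mathcal S(\omega)$ if and only if $m_i=1$ for every $i$ with $p_i\ne 0$. Moreover, $\mathcal S_{\mathrm{VN}}(\rho_\omega)=\mathcal S(\omega)$ holds for all states $\omega$ of $\mathfrak A$ if and only if the representation is multiplicity-free, i.e. $m_i=1$ for all $i$. -/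

import Mathlib

open scoped TensorProduct ComplexOrder

noncomputable section

namespace CStarEntropy

/-! ### States of a C⋆-algebra and their entropy -/

section States

variable (A : Type*) [CStarAlgebra A]

/-- The states of a unital C⋆-algebra: linear functionals `ω` with `ω(a⋆a) ≥ 0` for all `a` and
`ω(1) = ‖ω‖ = 1`. -/
def stateSpace : Set (A →L[ℂ] ℂ) :=
  {ω | (∀ a : A, 0 ≤ ω (star a * a)) ∧ ω 1 = 1 ∧ ‖ω‖ = 1}

/-- The pure states: the extreme points of the convex set of states. -/
def pureStates : Set (A →L[ℂ] ℂ) :=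
  (stateSpace A).extremePoints ℝ

end States

/-- Shannon entropy `H(p) = - ∑ᵢ pᵢ log pᵢ` (with `0 log 0 = 0`). -/
def shannonEntropy {ι : Type*} [Fintype ι] (p : ι → ℝ) : ℝ :=
  -∑ i, p i * Real.log (p i)

/-- The Shannon entropies of all the finite convex decompositions `ω = ∑ᵢ pᵢ ωᵢ` of `ω` into
pure states `ωᵢ`. -/
def decompositionEntropies {A : Type*} [CStarAlgebra A] (ω : A →L[ℂ] ℂ) : Set ℝ :=
  {h | ∃ (n : ℕ) (p : Fin n → ℝ) (τ : Fin n → (A →L[ℂ] ℂ)),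
    p ∈ stdSimplex ℝ (Fin n) ∧ (∀ i, τ i ∈ pureStates A) ∧
    ω = ∑ i, p i • τ i ∧ h = shannonEntropy p}

/-- The entropy of a state: the infimum of the Shannon entropies of its decompositions into
pure states. -/
def stateEntropy {A : Type*} [CStarAlgebra A] (ω : A →L[ℂ] ℂ) : ℝ :=
  sInf (decompositionEntropies ω)

/-! ### Density matrices and von Neumann entropy -/

section Operators

variable {H : Type*} [NormedAddCommGroup H] [InnerProductSpace ℂ H] [CompleteSpace H]

/-- The trace of an operator. -/
def trace (T : H →L[ℂ] H) : ℂ :=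
  LinearMap.trace ℂ H (T : H →ₗ[ℂ] H)

/-- A density matrix: a positive operator of trace one. -/
def IsDensity (ρ : H →L[ℂ] H) : Prop :=
  ρ.IsPositive ∧ trace ρ = 1

/-- The von Neumann entropy `- Tr (ρ log ρ)`, where `log ρ` is given by the functional calculus
(for the real logarithm with `log 0 = 0`, so that `0 log 0 = 0`). -/
def vonNeumannEntropy (ρ : H →L[ℂ] H) : ℝ :=
  -(trace (ρ * CFC.log ρ)).re

end Operators

/-! ### Representations -/

section Representations

variable {A : Type*} [CStarAlgebra A]
variable {H : Type*} [NormedAddCommGroup H] [InnerProductSpace ℂ H] [CompleteSpace H]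
variable {K : Type*} [NormedAddCommGroup K] [InnerProductSpace ℂ K] [CompleteSpace K]

/-- `ρ` is the distinguished representative of `ω` in the representation `π`: a density matrix
that belongs to `π(A)` and satisfies `ω(a) = Tr (ρ π(a))` for all `a`. -/
def IsRepresentative (π : A →⋆ₐ[ℂ] (H →L[ℂ] H)) (ω : A →L[ℂ] ℂ) (ρ : H →L[ℂ] H) : Prop :=
  ρ ∈ Set.range π ∧ IsDensity ρ ∧ ∀ a : A, ω a = trace (ρ * π a)

/-- Irreducibility of a representation on a (finite-dimensional) Hilbert space: the space is
nonzero and there are no invariant subspaces but the trivial ones. -/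
def IsIrreducible (π : A →⋆ₐ[ℂ] (H →L[ℂ] H)) : Prop :=
  Nontrivial H ∧
    ∀ V : Submodule ℂ H, (∀ a : A, ∀ v ∈ V, π a v ∈ V) → V = ⊥ ∨ V = ⊤

/-- Unitary equivalence of representations. -/
def UnitarilyEquivalent (π : A →⋆ₐ[ℂ] (H →L[ℂ] H)) (σ : A →⋆ₐ[ℂ] (K →L[ℂ] K)) : Prop :=
  ∃ W : H ≃ₗᵢ[ℂ] K, ∀ (a : A) (x : H), W (π a x) = σ a (W x)

end Representations

/-! ### Decomposition into irreducible blocks -/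

section Blocks

variable {ι : Type*} [Fintype ι]
variable {H : Type*} [NormedAddCommGroup H] [InnerProductSpace ℂ H] [FiniteDimensional ℂ H]
variable {K : ι → Type*} [∀ i, NormedAddCommGroup (K i)] [∀ i, InnerProductSpace ℂ (K i)]
  [∀ i, FiniteDimensional ℂ (K i)]

/-- The Hilbert space `⨁ᵢ Kᵢ ⊗ ℂ^{mᵢ}`. -/
abbrev BlockSpace (K : ι → Type*) [∀ i, NormedAddCommGroup (K i)]
    [∀ i, InnerProductSpace ℂ (K i)] (m : ι → ℕ) : Type _ :=
  PiLp 2 fun i => K i ⊗[ℂ] EuclideanSpace ℂ (Fin (m i))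

/-- The operator `⨁ᵢ Xᵢ ⊗ I` on `⨁ᵢ Kᵢ ⊗ ℂ^{mᵢ}`. -/
def blockSum (m : ι → ℕ) (X : ∀ i, K i →L[ℂ] K i) : BlockSpace K m →ₗ[ℂ] BlockSpace K m where
  toFun v := WithLp.toLp 2 fun i => TensorProduct.map (X i : K i →ₗ[ℂ] K i) LinearMap.id (v i)
  map_add' v w := by ext i; simp
  map_smul' c v := by ext i; simp

/-- The operator `⨁ᵢ Xᵢ ⊗ I`, seen on `H` through a unitary `U : H ≃ ⨁ᵢ Kᵢ ⊗ ℂ^{mᵢ}`. -/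
def blockOp {m : ι → ℕ} (U : H ≃ₗᵢ[ℂ] BlockSpace K m) (X : ∀ i, K i →L[ℂ] K i) : H →L[ℂ] H :=
  LinearMap.toContinuousLinearMap
    (U.symm.toLinearEquiv.toLinearMap ∘ₗ blockSum m X ∘ₗ U.toLinearEquiv.toLinearMap)

/-- A decomposition of the representation `π` on `H` into irreducible subrepresentations,
`(H, π) ≅ ⨁ᵢ (Kᵢ ⊗ ℂ^{mᵢ}, πᵢ ⊗ I)`, with pairwise inequivalent irreducible `πᵢ` and
multiplicities `mᵢ ≥ 1`. -/
structure IrreducibleDecomposition {A : Type*} [CStarAlgebra A] [CompleteSpace H]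
    (π : A →⋆ₐ[ℂ] (H →L[ℂ] H)) (K : ι → Type*) [∀ i, NormedAddCommGroup (K i)]
    [∀ i, InnerProductSpace ℂ (K i)] [∀ i, FiniteDimensional ℂ (K i)]
    [∀ i, CompleteSpace (K i)] (m : ι → ℕ) where
  /-- the irreducible representations `πᵢ` -/
  rep : ∀ i, A →⋆ₐ[ℂ] (K i →L[ℂ] K i)
  /-- the unitary equivalence -/
  U : H ≃ₗᵢ[ℂ] BlockSpace K m
  irreducible : ∀ i, IsIrreducible (rep i)
  inequivalent : ∀ i j, i ≠ j → ¬ UnitarilyEquivalent (rep i) (rep j)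
  mult_pos : ∀ i, 0 < m i
  map_eq : ∀ a, π a = blockOp U fun i => rep i a

/-- The operator `⨁ᵢ pᵢ (ρᵢ ⊗ I / mᵢ)` on `H`. -/
def canonicalOp {m : ι → ℕ} (U : H ≃ₗᵢ[ℂ] BlockSpace K m) (p : ι → ℝ)
    (σ : ∀ i, K i →L[ℂ] K i) : H →L[ℂ] H :=
  blockOp U fun i => ((p i / m i : ℝ) : ℂ) • σ i

/-- The operator `0 ⊕ ⋯ ⊕ (|ψ⟩⟨ψ| ⊗ I / mᵢ) ⊕ ⋯ ⊕ 0` on `H`, for a vector `ψ` of `Kᵢ`. -/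
def pureBlock [DecidableEq ι] {m : ι → ℕ} (U : H ≃ₗᵢ[ℂ] BlockSpace K m) (i : ι) (ψ : K i) :
    H →L[ℂ] H :=
  blockOp U (Pi.single i (((1 / m i : ℝ) : ℂ) • InnerProductSpace.rankOne ℂ ψ ψ))

end Blocks

end CStarEntropy

end

noncomputable section

namespace CStarEntropy

/-! ### Shannon entropy of mixtures of unit vectors -/

/-! The decomposition identifies the algebra with the full block algebra ⨁ B(K_i): faithfulness
gives injectivity, and Schur's lemma with Jacobson density gives surjectivity
(`exists_forall_rep_eq`). Every functional is then ω(a) = ∑ Tr(T_i π_i(a)) for some operators T_i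
(`exists_representedBy`). For a state the T_i are positive with total trace one, so T_i = p_i ρ_i.
Multiplicities play no role at this level: the trace over ℂ^{m_i} gives a factor m_i, which the
1/m_i in ρ_ω cancels. The pure states are exactly the vector states of single blocks, so a
decomposition of ω into pure states writes ⨁ T_i, on ⨁ K_i, as a mixture of projections onto unit
vectors, each inside one block.

The core is `shannonEntropy_le_of_mixture`. If ∑ q_k |φ_k⟩⟨φ_k| = ∑ w_x |ψ_x⟩⟨ψ_x| with the φ_k unit
and the ψ_x orthonormal, the matrix c_{kx} = q_k |⟨φ_k, ψ_x⟩|² / w_x carries w to q; summing over k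
gives 1 wherever w_x ≠ 0, and summing over x gives at most 1. Jensen's inequality for −t log t then
yields H(w) ≤ H(q). Hence the spectral decomposition is optimal, and the chain rule for entropy
evaluates its entropy as H(p) + ∑ p_i S_VN(ρ_i).

The eigenvalues of ρ_ω itself are p_i λ_j / m_i, each repeated m_i times, which adds the nonnegative
terms p_i log m_i. The last equivalence follows by testing on vector states of single blocks, which
have p_i ≠ 0. -/

lemma sum_mul_negMulLog_le {X : Type*} [Fintype X] (c w : X → ℝ) (hc : ∀ x, 0 ≤ c x)
    (hw : ∀ x, 0 ≤ w x) (hsum : ∑ x, c x ≤ 1) :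
    ∑ x, c x * Real.negMulLog (w x) ≤ Real.negMulLog (∑ x, c x * w x) := by
  set t := ∑ x, c x * w x with ht
  have ht0 : 0 ≤ t := Finset.sum_nonneg fun x _ => mul_nonneg (hc x) (hw x)
  rcases ht0.eq_or_lt with h0 | h0
  · have hz : ∀ x, c x * w x = 0 := fun x =>
      (Finset.sum_eq_zero_iff_of_nonneg fun x _ => mul_nonneg (hc x) (hw x)).1 h0.symm x
        (Finset.mem_univ x)
    have : ∑ x, c x * Real.negMulLog (w x) = 0 := by
      refine Finset.sum_eq_zero fun x _ => ?_
      have := hz x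
      simp only [Real.negMulLog]
      linear_combination (-Real.log (w x)) * this
    rw [this, ← h0]
    simp
  -- Tangent line of the concave function −s log s at s = t, obtained from log (t/w) ≤ t/w − 1. Its
  -- value at 0 is t ≥ 0, so the missing mass 1 − ∑ c costs nothing.
  · have key : ∀ x, c x * Real.negMulLog (w x) ≤ c x * t - c x * w x - c x * w x * Real.log t := by
      intro x
      rcases (hw x).eq_or_lt with h | h
      · rw [← h]
        have := mul_nonneg (hc x) ht0
        simpa using this
      · have hl := Real.log_le_sub_one_of_pos (div_pos h0 h)
        rw [Real.log_div h0.ne' h.ne'] at hl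
        have h1 := mul_le_mul_of_nonneg_left hl (mul_nonneg (hc x) h.le)
        have h2 : c x * w x * (t / w x - 1) = c x * t - c x * w x := by
          field_simp
        simp only [Real.negMulLog]
        linarith
    calc ∑ x, c x * Real.negMulLog (w x)
        ≤ ∑ x, (c x * t - c x * w x - c x * w x * Real.log t) := Finset.sum_le_sum fun x _ => key x
      _ = (∑ x, c x) * t - t - t * Real.log t := by
        rw [Finset.sum_sub_distrib, Finset.sum_sub_distrib, ← Finset.sum_mul, ← Finset.sum_mul]
      _ ≤ Real.negMulLog t := by
        simp only [Real.negMulLog]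
        nlinarith

lemma shannonEntropy_eq_sum_negMulLog {X : Type*} [Fintype X] (p : X → ℝ) :
    shannonEntropy p = ∑ x, Real.negMulLog (p x) := by
  simp [shannonEntropy, Real.negMulLog]

/-- Among the ways to write a positive operator as a mixture of projections onto unit vectors, a
spectral decomposition has the least Shannon entropy. -/
lemma shannonEntropy_le_of_mixture {E : Type*} [NormedAddCommGroup E] [InnerProductSpace ℂ E]
    {κ X : Type*} [Fintype κ] [Fintype X] {w : X → ℝ} {q : κ → ℝ} (hw : ∀ x, 0 ≤ w x)
    (hq : ∀ k, 0 ≤ q k) {ψ : X → E} (hψ : Orthonormal ℂ ψ) {φ : κ → E} (hφ : ∀ k, ‖φ k‖ = 1)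
    (h : ∀ v, ∑ k, q k * ‖inner ℂ (φ k) v‖ ^ 2 = ∑ x, w x * ‖inner ℂ (ψ x) v‖ ^ 2) :
    shannonEntropy w ≤ shannonEntropy q := by
  classical
  set a : κ → X → ℝ := fun k x => ‖inner ℂ (φ k) (ψ x)‖ ^ 2 with ha
  have a0 : ∀ k x, 0 ≤ a k x := fun k x => sq_nonneg _
  have aa : ∀ k x, (a k x : ℂ) = inner ℂ (φ k) (ψ x) * inner ℂ (ψ x) (φ k) := by
    intro k x
    rw [← inner_conj_symm (ψ x) (φ k), Complex.mul_conj, Complex.normSq_eq_norm_sq]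
  have hcol : ∀ x, ∑ k, q k * a k x = w x := by
    intro x
    rw [h (ψ x), Finset.sum_eq_single x]
    · simp [hψ.1 x]
    · intro y _ hy
      simp [hψ.2 hy]
    · simp
  have hzero : ∀ k x, w x = 0 → q k * a k x = 0 := by
    intro k x hx
    exact (Finset.sum_eq_zero_iff_of_nonneg fun k _ => mul_nonneg (hq k) (a0 k x)).1
      ((hcol x).trans hx) k (Finset.mem_univ k)
  have hcoef : ∀ (l : X → ℂ) x, inner ℂ (ψ x) (∑ y, l y • ψ y) = l x := fun l x =>
    hψ.inner_right_fintype l x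
  -- If q_k ≠ 0, then φ_k lies in the span of the ψ_x: on the component v of φ_k orthogonal to all
  -- of them, the right side of `h` vanishes.
  have hrow : ∀ k, ∑ x, q k * a k x = q k := by
    intro k
    set v := φ k - ∑ x, (inner ℂ (ψ x) (φ k)) • ψ x with hv
    have h1 : ∀ x, inner ℂ (ψ x) v = 0 := by
      intro x
      rw [hv, inner_sub_right, hcoef, sub_self]
    have h2 : inner ℂ (φ k) v = ((1 - ∑ x, a k x : ℝ) : ℂ) := by
      rw [hv, inner_sub_right, inner_self_eq_norm_sq_to_K, hφ, _root_.inner_sum]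
      push_cast
      simp only [inner_smul_right, aa]
      simp [mul_comm]
    have h3 := h v
    simp only [h1, norm_zero] at h3
    have h4 := (Finset.sum_eq_zero_iff_of_nonneg
      fun k _ => mul_nonneg (hq k) (sq_nonneg _)).1 (h3.trans (by simp)) k (Finset.mem_univ k)
    rw [← Finset.mul_sum]
    rcases mul_eq_zero.1 h4 with h5 | h5
    · simp [h5]
    · rw [h2, sq_eq_zero_iff, norm_eq_zero, Complex.ofReal_eq_zero] at h5
      linear_combination -q k * h5
  have hbound : ∀ k, ∑ x, q k * a k x / w x ≤ 1 := by
    intro k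
    set s := ∑ x, a k x / w x with hs
    have hs0 : 0 ≤ s := Finset.sum_nonneg fun x _ => div_nonneg (a0 k x) (hw x)
    -- With ρ = ∑ w_x |ψ_x⟩⟨ψ_x|, this is ρ⁻¹ φ_k on the support of ρ; division by zero drops the x
    -- with w_x = 0. The bound q_k |⟨φ_k, v⟩|² ≤ ⟨v, ρ v⟩ becomes q_k s² ≤ s.
    set v := ∑ x, (inner ℂ (ψ x) (φ k) / (w x : ℂ)) • ψ x with hv
    have h1 : ∑ x, w x * ‖inner ℂ (ψ x) v‖ ^ 2 = s := by
      refine Finset.sum_congr rfl fun x _ => ?_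
      rw [hv, hcoef, norm_div, Complex.norm_real, Real.norm_of_nonneg (hw x), div_pow,
        norm_inner_symm]
      rcases eq_or_ne (w x) 0 with h0 | h0
      · simp [h0]
      · simp only [ha]
        field_simp
    have h2 : inner ℂ (φ k) v = (s : ℂ) := by
      rw [hv, _root_.inner_sum, hs]
      push_cast
      refine Finset.sum_congr rfl fun x _ => ?_
      rw [inner_smul_right, aa]
      ring
    have h3 : q k * s ^ 2 ≤ s := by
      have := Finset.single_le_sum (f := fun k => q k * ‖inner ℂ (φ k) v‖ ^ 2)
        (fun k _ => mul_nonneg (hq k) (sq_nonneg _)) (Finset.mem_univ k)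
      rw [h v, h1, h2, Complex.norm_real, Real.norm_of_nonneg hs0] at this
      exact this
    have h4 : ∑ x, q k * a k x / w x = q k * s := by
      rw [hs, Finset.mul_sum]
      exact Finset.sum_congr rfl fun x _ => mul_div_assoc _ _ _
    rw [h4]
    rcases hs0.eq_or_lt with h0 | h0
    · simp [← h0]
    · by_contra! hlt
      nlinarith
  rw [shannonEntropy_eq_sum_negMulLog, shannonEntropy_eq_sum_negMulLog]
  calc ∑ x, Real.negMulLog (w x)
      = ∑ x, ∑ k, q k * a k x / w x * Real.negMulLog (w x) := by
        refine Finset.sum_congr rfl fun x _ => ?_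
        rw [← Finset.sum_mul, ← Finset.sum_div, hcol]
        rcases eq_or_ne (w x) 0 with h0 | h0
        · simp [h0]
        · rw [div_self h0, one_mul]
    _ = ∑ k, ∑ x, q k * a k x / w x * Real.negMulLog (w x) := Finset.sum_comm
    _ ≤ ∑ k, Real.negMulLog (q k) := by
        refine Finset.sum_le_sum fun k _ => ?_
        refine (sum_mul_negMulLog_le (fun x => q k * a k x / w x) w
          (fun x => div_nonneg (mul_nonneg (hq k) (a0 k x)) (hw x)) hw (hbound k)).trans
          (le_of_eq ?_)
        congr 1
        refine (Finset.sum_congr rfl fun x _ => ?_).trans (hrow k)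
        rcases eq_or_ne (w x) 0 with h0 | h0
        · rw [hzero k x h0, h0, mul_zero]
        · rw [div_mul_cancel₀ _ h0]

lemma shannonEntropy_comp_equiv {X Y : Type*} [Fintype X] [Fintype Y] (e : X ≃ Y) (p : Y → ℝ) :
    shannonEntropy (p ∘ e) = shannonEntropy p := by
  simp only [shannonEntropy, Function.comp]
  rw [e.sum_comp fun y => p y * Real.log (p y)]

/-- The entropy of a probability vector that is conditioned on a partition. -/
lemma shannonEntropy_sigma {ι : Type*} [Fintype ι] {κ : ι → Type*} [∀ i, Fintype (κ i)]
    (p : ι → ℝ) (l : ∀ i, κ i → ℝ) (hl : ∀ i, ∑ j, l i j = 1) :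
    shannonEntropy (fun x : Σ i, κ i => p x.1 * l x.1 x.2) =
      shannonEntropy p + ∑ i, p i * shannonEntropy (l i) := by
  simp only [shannonEntropy_eq_sum_negMulLog, Fintype.sum_sigma, Real.negMulLog_mul,
    Finset.sum_add_distrib, ← Finset.sum_mul, hl, one_mul, ← Finset.mul_sum]

/-! ### Traces and von Neumann entropy -/

section Operators

variable {H : Type*} [NormedAddCommGroup H] [InnerProductSpace ℂ H]

lemma trace_add (S T : H →L[ℂ] H) : trace (S + T) = trace S + trace T := by
  simp [trace]

lemma trace_sub (S T : H →L[ℂ] H) : trace (S - T) = trace S - trace T := by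
  simp [trace]

lemma trace_smul (c : ℂ) (T : H →L[ℂ] H) : trace (c • T) = c * trace T := by
  simp [trace]

lemma trace_sum {κ : Type*} (s : Finset κ) (T : κ → H →L[ℂ] H) :
    trace (∑ i ∈ s, T i) = ∑ i ∈ s, trace (T i) := by
  simp [trace]

lemma trace_eq_sum_of_eigenbasis {κ : Type*} [Fintype κ] (b : Module.Basis κ ℂ H)
    (T : H →L[ℂ] H) (μ : κ → ℂ) (h : ∀ j, T (b j) = μ j • b j) : trace T = ∑ j, μ j := by
  classical
  rw [trace, LinearMap.trace_eq_matrix_trace ℂ b]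
  simp [Matrix.trace, LinearMap.toMatrix_apply, h]

lemma aeval_apply_of_apply_eq_smul (q : Polynomial ℝ) {T : H →L[ℂ] H} {v : H} {μ : ℝ}
    (hv : T v = (μ : ℂ) • v) : Polynomial.aeval T q v = ((q.eval μ : ℝ) : ℂ) • v := by
  induction q using Polynomial.induction_on with
  | C a => simp [Algebra.algebraMap_eq_smul_one]
  | add p q hp hq => simp [hp, hq, add_smul]
  | monomial n a h =>
    rw [pow_succ, ← mul_assoc, map_mul, mul_apply_eq_comp, Polynomial.aeval_X, hv, map_smul, h,
      smul_smul]
    simp only [Polynomial.eval_mul, Polynomial.eval_X, Complex.ofReal_mul, mul_comm]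

variable [FiniteDimensional ℂ H]

lemma trace_rankOne (x y : H) : trace (InnerProductSpace.rankOne ℂ x y) = inner ℂ y x :=
  InnerProductSpace.trace_rankOne x y

lemma trace_mul_rankOne (T : H →L[ℂ] H) (x y : H) :
    trace (T * InnerProductSpace.rankOne ℂ x y) = inner ℂ y (T x) := by
  rw [← trace_rankOne]
  congr 1
  ext z
  simp

lemma trace_rankOne_mul (T : H →L[ℂ] H) (x y : H) :
    trace (InnerProductSpace.rankOne ℂ x y * T) = inner ℂ y (T x) := by
  rw [← trace_mul_rankOne]
  exact LinearMap.trace_mul_comm ℂ _ _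

/-- The spectrum lies among the roots of the minimal polynomial. Finiteness lets interpolation
polynomials replace arbitrary functions in the functional calculus. -/
lemma finite_spectrum_real (T : H →L[ℂ] H) : (spectrum ℝ T).Finite := by
  have : FiniteDimensional ℝ (H →L[ℂ] H) := FiniteDimensional.complexToReal _
  have hT : IsIntegral ℝ T := Algebra.IsIntegral.isIntegral T
  rcases subsingleton_or_nontrivial (H →L[ℂ] H) with hs | hs
  · rw [spectrum.of_subsingleton]
    exact Set.finite_empty
  · refine (minpoly ℝ T).rootSet_finite ℝ |>.subset fun x hx => ?_
    have := spectrum.subset_polynomial_aeval T (minpoly ℝ T) ⟨x, hx, rfl⟩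
    rw [minpoly.aeval, spectrum.zero_eq] at this
    rw [Polynomial.mem_rootSet]
    exact ⟨minpoly.ne_zero hT, by simpa [Polynomial.coe_aeval_eq_eval] using this⟩

variable [CompleteSpace H]

lemma cfc_apply_of_apply_eq_smul (f : ℝ → ℝ) {T : H →L[ℂ] H} (hT : IsSelfAdjoint T) {v : H}
    {μ : ℝ} (hv : T v = (μ : ℂ) • v) : cfc f T v = ((f μ : ℝ) : ℂ) • v := by
  classical
  -- μ is inserted separately, since v may be zero and μ then need not be in the spectrum.
  set s : Finset ℝ := insert μ (finite_spectrum_real T).toFinset with hs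
  set q := Lagrange.interpolate s id f
  have hq : ∀ x ∈ s, q.eval x = f x := fun x hx =>
    Lagrange.eval_interpolate_at_node (v := id) f (Set.injOn_id _) hx
  have h1 : cfc f T = cfc q.eval T := cfc_congr fun x hx => by
    rw [hq x (by simp [hs, hx])]
  rw [h1, cfc_polynomial q T hT, aeval_apply_of_apply_eq_smul q hv, hq μ (by simp [hs])]

/-- The trace needs no orthonormality, so any eigenbasis serves, in particular one assembled from
tensor products. -/
lemma vonNeumannEntropy_eq_of_eigenbasis {κ : Type*} [Fintype κ] (b : Module.Basis κ ℂ H)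
    {T : H →L[ℂ] H} (hT : IsSelfAdjoint T) (μ : κ → ℝ) (h : ∀ j, T (b j) = (μ j : ℂ) • b j) :
    vonNeumannEntropy T = shannonEntropy μ := by
  have h1 : trace (T * CFC.log T) = ∑ j, ((μ j * Real.log (μ j) : ℝ) : ℂ) := by
    refine trace_eq_sum_of_eigenbasis b _ _ fun j => ?_
    rw [mul_apply_eq_comp, CFC.log, cfc_apply_of_apply_eq_smul _ hT (h j), map_smul,
      h j, smul_smul, mul_comm]
    push_cast
    rfl
  rw [vonNeumannEntropy, h1, ← Complex.ofReal_sum, Complex.ofReal_re, shannonEntropy]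

end Operators

/-! ### Irreducible representations -/

section Irreducible

variable {A : Type*} [CStarAlgebra A]
variable {H : Type*} [NormedAddCommGroup H] [InnerProductSpace ℂ H] [FiniteDimensional ℂ H]
  [CompleteSpace H]
variable {K : Type*} [NormedAddCommGroup K] [InnerProductSpace ℂ K] [CompleteSpace K]

/-- Schur's lemma: the operators that commute with an irreducible representation are scalar. -/
lemma IsIrreducible.exists_eq_smul {π : A →⋆ₐ[ℂ] (H →L[ℂ] H)} (hπ : IsIrreducible π)
    (T : H →ₗ[ℂ] H) (hT : ∀ a x, T (π a x) = π a (T x)) : ∃ c : ℂ, ∀ x, T x = c • x := by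
  have := hπ.1
  obtain ⟨c, hc⟩ := Module.End.exists_eigenvalue T
  refine ⟨c, fun x => ?_⟩
  have hinv : ∀ a : A, ∀ v ∈ Module.End.eigenspace T c, π a v ∈ Module.End.eigenspace T c := by
    intro a v hv
    rw [Module.End.mem_eigenspace_iff] at hv ⊢
    rw [hT, hv, map_smul]
  have htop := (hπ.2 _ hinv).resolve_left hc
  exact Module.End.mem_eigenspace_iff.1 (htop ▸ Submodule.mem_top)

/-- A nonzero intertwiner of irreducible representations yields a unitary equivalence. -/
lemma IsIrreducible.unitarilyEquivalent {π : A →⋆ₐ[ℂ] (H →L[ℂ] H)} {σ : A →⋆ₐ[ℂ] (K →L[ℂ] K)}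
    (hπ : IsIrreducible π) (hσ : IsIrreducible σ) (W : H →L[ℂ] K) (hW : W ≠ 0)
    (h : ∀ a x, W (π a x) = σ a (W x)) : UnitarilyEquivalent π σ := by
  -- Representations preserve adjoints, so W* intertwines in the other direction. Then W*W commutes
  -- with π, is scalar by Schur's lemma, and W is a multiple of an isometry.
  have hadj : ∀ a y, W.adjoint (σ a y) = π a (W.adjoint y) := by
    intro a y
    refine ext_inner_left ℂ fun x => ?_
    have h1 : ∀ x y, inner ℂ x (π a y) = inner ℂ (π (star a) x) y := by
      intro x y
      rw [map_star, ContinuousLinearMap.star_eq_adjoint, ContinuousLinearMap.adjoint_inner_left]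
    have h2 : ∀ x y, inner ℂ x (σ a y) = inner ℂ (σ (star a) x) y := by
      intro x y
      rw [map_star, ContinuousLinearMap.star_eq_adjoint, ContinuousLinearMap.adjoint_inner_left]
    rw [ContinuousLinearMap.adjoint_inner_right, h1, ContinuousLinearMap.adjoint_inner_right, h2, h]
  obtain ⟨c, hc⟩ := hπ.exists_eq_smul ((W.adjoint ∘L W : H →L[ℂ] H) : H →ₗ[ℂ] H) (by
    intro a x
    simp [h, hadj])
  have hc : ∀ x, W.adjoint (W x) = c • x := fun x => by simpa using hc x
  have hnorm : ∀ x, ((‖W x‖ ^ 2 : ℝ) : ℂ) = c * ((‖x‖ ^ 2 : ℝ) : ℂ) := by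
    intro x
    have h1 : inner ℂ x (W.adjoint (W x)) = ((‖W x‖ ^ 2 : ℝ) : ℂ) := by
      rw [ContinuousLinearMap.adjoint_inner_right, inner_self_eq_norm_sq_to_K]
      simp
    rw [← h1, hc, inner_smul_right, inner_self_eq_norm_sq_to_K]
    simp
  obtain ⟨x₀, hx₀⟩ : ∃ x, W x ≠ 0 := by
    by_contra! hcon
    exact hW (by ext x; simp [hcon])
  have hx₀' : x₀ ≠ 0 := fun h0 => hx₀ (by simp [h0])
  have hreal : c = ((‖W x₀‖ ^ 2 / ‖x₀‖ ^ 2 : ℝ) : ℂ) := by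
    rw [Complex.ofReal_div, hnorm, mul_div_cancel_right₀]
    exact_mod_cast (pow_pos (norm_pos_iff.2 hx₀') 2).ne'
  set r : ℝ := ‖W x₀‖ / ‖x₀‖ with hr
  have hr0 : 0 < r := div_pos (norm_pos_iff.2 hx₀) (norm_pos_iff.2 hx₀')
  have hnorm' : ∀ x, ‖W x‖ = r * ‖x‖ := by
    intro x
    have h1 := hnorm x
    rw [hreal, ← Complex.ofReal_mul, Complex.ofReal_inj, ← div_pow, ← hr, ← mul_pow] at h1
    exact (pow_left_inj₀ (norm_nonneg _) (by positivity) two_ne_zero).1 h1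
  let V : H →ₗᵢ[ℂ] K :=
    { toLinearMap := ((r⁻¹ : ℝ) : ℂ) • (W : H →ₗ[ℂ] K)
      norm_map' := fun x => by
        rw [LinearMap.smul_apply, norm_smul, Complex.norm_real, Real.norm_of_nonneg (by positivity),
          ContinuousLinearMap.coe_coe, hnorm']
        field_simp }
  have hV : ∀ x, V x = ((r⁻¹ : ℝ) : ℂ) • W x := fun x => rfl
  have hVint : ∀ a x, V (π a x) = σ a (V x) := by
    intro a x
    rw [hV, hV, h, map_smul]
  have hsurj : Function.Surjective V := by
    have h1 : LinearMap.range V.toLinearMap = ⊤ := by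
      refine (hσ.2 _ ?_).resolve_left ?_
      · rintro a _ ⟨x, rfl⟩
        exact ⟨π a x, hVint a x⟩
      · intro hbot
        have h2 : V x₀ ∈ LinearMap.range V.toLinearMap := ⟨x₀, rfl⟩
        rw [hbot, Submodule.mem_bot] at h2
        exact hx₀' (V.injective (h2.trans V.map_zero.symm))
    exact LinearMap.range_eq_top.1 h1
  exact ⟨LinearIsometryEquiv.ofSurjective V hsurj, hVint⟩

end Irreducible

/-! ### Joint surjectivity of inequivalent irreducible representations -/

section Density

variable {A : Type*} [CStarAlgebra A] {ι : Type*} [Fintype ι]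
variable {K : ι → Type*} [∀ i, NormedAddCommGroup (K i)] [∀ i, InnerProductSpace ℂ (K i)]
  [∀ i, FiniteDimensional ℂ (K i)] [∀ i, CompleteSpace (K i)]

/-- Density theorem: the algebra maps onto the product of the full operator algebras of pairwise
inequivalent irreducible representations. -/
lemma exists_forall_rep_eq (rep : ∀ i, A →⋆ₐ[ℂ] (K i →L[ℂ] K i))
    (hirr : ∀ i, IsIrreducible (rep i))
    (hineq : ∀ i j, i ≠ j → ¬ UnitarilyEquivalent (rep i) (rep j)) (X : ∀ i, K i →L[ℂ] K i) :
    ∃ a : A, ∀ i, rep i a = X i := by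
  classical
  let _ : ∀ i, Module A (K i) := fun i => Module.compHom (K i) (rep i : A →+* (K i →L[ℂ] K i))
  have smul_def : ∀ i (a : A) (x : K i), a • x = rep i a x := fun i a x => rfl
  have algebraMap_smul : ∀ i (c : ℂ) (x : K i), algebraMap ℂ A c • x = c • x := by
    intro i c x
    rw [smul_def, AlgHomClass.commutes, Algebra.algebraMap_eq_smul_one]
    simp
  have hsimple : ∀ i, IsSimpleModule A (K i) := by
    intro i
    have := (hirr i).1
    rw [isSimpleModule_iff]
    exact
      { eq_bot_or_eq_top := fun V => by
          let V' : Submodule ℂ (K i) :=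
            { V.toAddSubmonoid with
              smul_mem' := fun c x hx => by
                rw [← algebraMap_smul]
                exact V.smul_mem _ hx }
          have hmem : ∀ x, x ∈ V' ↔ x ∈ V := fun x => Iff.rfl
          rcases (hirr i).2 V' (fun a v hv => V.smul_mem a hv) with h | h
          · left
            ext x
            rw [← hmem, h]
            simp
          · right
            ext x
            rw [← hmem, h]
            simp }
  have map_complex : ∀ {i j} (g : K i →ₗ[A] K j) (c : ℂ) (x : K i), g (c • x) = c • g x := by
    intro i j g c x
    rw [← algebraMap_smul, map_smul, algebraMap_smul]
  let toComplex : ∀ {i j}, (K i →ₗ[A] K j) → (K i →ₗ[ℂ] K j) := fun g =>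
    { toFun := g, map_add' := map_add g, map_smul' := map_complex g }
  have hoff : ∀ {i j}, i ≠ j → ∀ g : K i →ₗ[A] K j, g = 0 := by
    intro i j hij g
    by_contra hg
    refine hineq i j hij ((hirr i).unitarilyEquivalent (hirr j)
      (LinearMap.toContinuousLinearMap (toComplex g)) ?_ fun a x => ?_)
    · intro h0
      exact hg (by ext x; exact congr($h0 x))
    · exact map_smul g a x
  have hdiag : ∀ (i) (g : K i →ₗ[A] K i), ∃ c : ℂ, ∀ x, g x = c • x := fun i g =>
    (hirr i).exists_eq_smul (toComplex g) fun a x => map_smul g a x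
  -- An A-linear endomorphism of the product is a scalar on each coordinate: off-diagonal parts
  -- vanish by inequivalence, diagonal ones are scalar by Schur. Hence it commutes with X, as the
  -- density theorem requires.
  have hcomm : ∀ (g : Module.End A (∀ i, K i)) (v : ∀ i, K i) (j),
      X j (g v j) = g (fun i => X i (v i)) j := by
    intro g v j
    obtain ⟨c, hc⟩ := hdiag j (LinearMap.proj j ∘ₗ g ∘ₗ LinearMap.single A K j)
    have hg : ∀ v : ∀ i, K i, g v j = c • v j := by
      intro v
      have h1 : v = ∑ i, Pi.single i (v i) := (Finset.univ_sum_single v).symm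
      conv_lhs => rw [h1, map_sum, Finset.sum_apply]
      rw [Finset.sum_eq_single j]
      · exact hc (v j)
      · intro i _ hij
        exact congr($(hoff hij (LinearMap.proj j ∘ₗ g ∘ₗ LinearMap.single A K i)) (v i))
      · simp
    rw [hg, hg, map_smul]
  let f : Module.End (Module.End A (∀ i, K i)) (∀ i, K i) :=
    { toFun := fun v i => X i (v i)
      map_add' := fun v w => by ext i; simp
      map_smul' := fun g v => by
        ext j
        exact hcomm g v j }
  let b : ∀ i, Module.Basis (Fin (Module.finrank ℂ (K i))) ℂ (K i) := fun i =>
    Module.finBasis ℂ (K i)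
  -- Density gives agreement on a finite set; the vectors of a basis suffice for equality of
  -- operators.
  obtain ⟨a, ha⟩ := jacobson_density f
    (Finset.univ.image fun x : Σ i, Fin (Module.finrank ℂ (K i)) => Pi.single x.1 (b x.1 x.2))
  refine ⟨a, fun i => ContinuousLinearMap.coe_injective ((b i).ext fun j => ?_)⟩
  have h1 := congrFun (ha _ (Finset.mem_image_of_mem _ (Finset.mem_univ ⟨i, j⟩))) i
  have h2 : f (Pi.single i (b i j)) i = X i (b i j) := by simp [f]
  have h3 : (a • (Pi.single i (b i j) : ∀ i, K i)) i = rep i a (b i j) := by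
    rw [Pi.smul_apply, Pi.single_eq_same]
    rfl
  exact (h2.symm.trans (h1.trans h3)).symm

end Density

/-! ### Block operators -/

lemma blockSum_apply {ι : Type*} {K : ι → Type*} [∀ i, NormedAddCommGroup (K i)]
    [∀ i, InnerProductSpace ℂ (K i)] {m : ι → ℕ} (X : ∀ i, K i →L[ℂ] K i) (v : BlockSpace K m) (i : ι) :
    blockSum m X v i = TensorProduct.map (X i : K i →ₗ[ℂ] K i) LinearMap.id (v i) := rfl

section BlockOperators

variable {ι : Type*} [Fintype ι]
variable {H : Type*} [NormedAddCommGroup H] [InnerProductSpace ℂ H]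
variable {K : ι → Type*} [∀ i, NormedAddCommGroup (K i)] [∀ i, InnerProductSpace ℂ (K i)]
variable {m : ι → ℕ} (U : H ≃ₗᵢ[ℂ] BlockSpace K m)

/-- The basis of `H` adapted to a unitary `H ≃ ⨁ᵢ Kᵢ ⊗ ℂ^{mᵢ}` and to bases of the `Kᵢ`. -/
def blockBasis {κ : ι → Type*} (b : ∀ i, Module.Basis (κ i) ℂ (K i)) :
    Module.Basis (Σ i, κ i × Fin (m i)) ℂ H :=
  ((Pi.basis fun i => (b i).tensorProduct
    (EuclideanSpace.basisFun (Fin (m i)) ℂ).toBasis).map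
      (WithLp.linearEquiv 2 ℂ (∀ i, K i ⊗[ℂ] EuclideanSpace ℂ (Fin (m i)))).symm).map
        U.symm.toLinearEquiv

lemma blockBasis_apply [DecidableEq ι] {κ : ι → Type*} (b : ∀ i, Module.Basis (κ i) ℂ (K i))
    (x : Σ i, κ i × Fin (m i)) :
    blockBasis U b x = U.symm (WithLp.toLp 2 (Pi.single x.1
      (b x.1 x.2.1 ⊗ₜ[ℂ] EuclideanSpace.basisFun (Fin (m x.1)) ℂ x.2.2))) := by
  obtain ⟨i, j, k⟩ := x
  simp only [blockBasis, Module.Basis.map_apply, Pi.basis_apply, Module.Basis.tensorProduct_apply]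
  congr 3

variable [FiniteDimensional ℂ H]

lemma blockOp_apply (X : ∀ i, K i →L[ℂ] K i) (x : H) :
    blockOp U X x = U.symm (blockSum m X (U x)) := rfl

lemma blockOp_blockBasis {κ : ι → Type*} (b : ∀ i, Module.Basis (κ i) ℂ (K i))
    (X : ∀ i, K i →L[ℂ] K i) (μ : ∀ i, κ i → ℂ) (h : ∀ i j, X i (b i j) = μ i j • b i j)
    (x : Σ i, κ i × Fin (m i)) :
    blockOp U X (blockBasis U b x) = μ x.1 x.2.1 • blockBasis U b x := by
  classical
  rw [blockBasis_apply, blockOp_apply, LinearIsometryEquiv.apply_symm_apply, ← map_smul]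
  congr 1
  ext i
  rw [blockSum_apply]
  change _ = μ x.1 x.2.1 • (Pi.single x.1
    (b x.1 x.2.1 ⊗ₜ[ℂ] EuclideanSpace.basisFun (Fin (m x.1)) ℂ x.2.2) :
      ∀ i, K i ⊗[ℂ] EuclideanSpace ℂ (Fin (m i))) i
  rcases eq_or_ne i x.1 with rfl | hi
  · simp [h, TensorProduct.smul_tmul']
  · simp [hi]

/-- Tensoring with ℂ^{m_i} repeats every eigenvalue of block i exactly m_i times. -/
lemma vonNeumannEntropy_blockOp [CompleteSpace H] {κ : ι → Type*} [∀ i, Fintype (κ i)]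
    (b : ∀ i, Module.Basis (κ i) ℂ (K i)) (X : ∀ i, K i →L[ℂ] K i)
    (hX : IsSelfAdjoint (blockOp U X)) (μ : ∀ i, κ i → ℝ)
    (h : ∀ i j, X i (b i j) = (μ i j : ℂ) • b i j) :
    vonNeumannEntropy (blockOp U X) = ∑ i, m i * shannonEntropy (μ i) := by
  rw [vonNeumannEntropy_eq_of_eigenbasis (blockBasis U b) hX (fun x => μ x.1 x.2.1)
    (blockOp_blockBasis U b X (fun i j => (μ i j : ℂ)) h)]
  simp only [shannonEntropy, Fintype.sum_sigma, Fintype.sum_prod_type, Finset.sum_const,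
    Finset.card_univ, Fintype.card_fin, nsmul_eq_mul, ← Finset.mul_sum, Finset.sum_neg_distrib,
    mul_neg]

lemma blockOp_mul (X Y : ∀ i, K i →L[ℂ] K i) :
    blockOp U X * blockOp U Y = blockOp U fun i => X i * Y i := by
  ext x
  rw [mul_apply_eq_comp, blockOp_apply, blockOp_apply, blockOp_apply,
    LinearIsometryEquiv.apply_symm_apply]
  congr 1
  ext i
  simp only [blockSum_apply]
  rw [← LinearMap.comp_apply, ← TensorProduct.map_comp]
  rfl

variable [∀ i, FiniteDimensional ℂ (K i)]

lemma trace_blockOp (X : ∀ i, K i →L[ℂ] K i) :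
    trace (blockOp U X) = ∑ i, (m i : ℂ) * trace (X i) := by
  classical
  let T : ∀ i, K i ⊗[ℂ] EuclideanSpace ℂ (Fin (m i)) →ₗ[ℂ] K i ⊗[ℂ] EuclideanSpace ℂ (Fin (m i)) :=
    fun i => TensorProduct.map (X i : K i →ₗ[ℂ] K i) LinearMap.id
  let e : H ≃ₗ[ℂ] (∀ i, K i ⊗[ℂ] EuclideanSpace ℂ (Fin (m i))) :=
    U.toLinearEquiv.trans (WithLp.linearEquiv 2 ℂ _)
  have h1 : e.conj (blockOp U X : H →ₗ[ℂ] H) =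
      ∑ i, LinearMap.single ℂ _ i ∘ₗ (T i ∘ₗ LinearMap.proj i) := by
    refine LinearMap.ext fun v => ?_
    have h2 : e.conj (blockOp U X : H →ₗ[ℂ] H) v = fun i => T i (v i) := by
      rw [LinearEquiv.conj_apply_apply]
      change (U (U.symm (blockSum m X (U (U.symm (WithLp.toLp 2 v)))))).ofLp = _
      rw [LinearIsometryEquiv.apply_symm_apply, LinearIsometryEquiv.apply_symm_apply]
      rfl
    rw [h2]
    simp only [LinearMap.sum_apply, LinearMap.comp_apply, LinearMap.proj_apply]
    exact (Finset.univ_sum_single fun i => T i (v i)).symm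
  rw [trace, ← LinearMap.trace_conj' _ e, h1, map_sum]
  refine Finset.sum_congr rfl fun i _ => ?_
  -- Cyclicity of the trace brings the projection next to the inclusion of the same block, leaving
  -- Tr(X_i ⊗ I) = m_i Tr X_i.
  rw [LinearMap.trace_comp_comm', LinearMap.comp_assoc, LinearMap.proj_comp_single_same,
    LinearMap.comp_id, LinearMap.trace_tensorProduct', LinearMap.trace_id]
  simp [trace, mul_comm]

end BlockOperators

/-! ### Spectral decomposition of positive operators -/

section Spectral

variable {K : Type*} [NormedAddCommGroup K] [InnerProductSpace ℂ K] [FiniteDimensional ℂ K]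

lemma exists_spectral_decomposition {T : K →L[ℂ] K} (hT : T.IsPositive) :
    ∃ (l : Fin (Module.finrank ℂ K) → ℝ) (b : OrthonormalBasis (Fin (Module.finrank ℂ K)) ℂ K),
      (∀ j, 0 ≤ l j) ∧ (∀ j, T (b j) = (l j : ℂ) • b j) ∧
      T = ∑ j, (l j : ℂ) • InnerProductSpace.rankOne ℂ (b j) (b j) := by
  have hs : (T : K →ₗ[ℂ] K).IsSymmetric := hT.isSymmetric
  have hb : ∀ j, T (hs.eigenvectorBasis rfl j) =
      (hs.eigenvalues rfl j : ℂ) • hs.eigenvectorBasis rfl j := hs.apply_eigenvectorBasis rfl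
  refine ⟨hs.eigenvalues rfl, hs.eigenvectorBasis rfl,
    hT.toLinearMap.nonneg_eigenvalues rfl, hb, ?_⟩
  refine ContinuousLinearMap.coe_injective
    ((hs.eigenvectorBasis rfl).toBasis.ext fun j => ?_)
  simp [orthonormal_iff_ite.1 (hs.eigenvectorBasis rfl).orthonormal]

lemma eq_zero_of_isPositive_of_trace_eq_zero {T : K →L[ℂ] K} (hT : T.IsPositive)
    (h : trace T = 0) : T = 0 := by
  obtain ⟨l, b, hl, -, hTl⟩ := exists_spectral_decomposition hT
  rw [hTl, trace_sum] at h
  simp only [trace_smul, trace_rankOne, orthonormal_iff_ite.1 b.orthonormal, if_true,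
    mul_one] at h
  have h1 : ∑ j, l j = 0 := by exact_mod_cast h
  rw [Finset.sum_eq_zero_iff_of_nonneg fun j _ => hl j] at h1
  rw [hTl]
  exact Finset.sum_eq_zero fun j hj => by simp [h1 j hj]

/-- The trace is faithful. -/
lemma eq_zero_of_trace_mul_star_eq_zero [CompleteSpace K] {S : K →L[ℂ] K}
    (h : trace (S * star S) = 0) : S = 0 := by
  have hpos : (S * star S).IsPositive := by
    rw [← ContinuousLinearMap.nonneg_iff_isPositive]
    exact mul_star_self_nonneg _
  exact (CStarRing.mul_star_self_eq_zero_iff S).1 (eq_zero_of_isPositive_of_trace_eq_zero hpos h)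

lemma IsDensity.sum_eigenvalues [CompleteSpace K] {κ : Type*} [Fintype κ] {T : K →L[ℂ] K}
    (hT : IsDensity T)
    {l : κ → ℝ} {ψ : κ → K} (hψ : Orthonormal ℂ ψ)
    (h : T = ∑ j, (l j : ℂ) • InnerProductSpace.rankOne ℂ (ψ j) (ψ j)) :
    (∀ j, 0 ≤ l j) ∧ ∑ j, l j = 1 := by
  classical
  constructor
  · intro j
    have h1 := hT.1.inner_nonneg_right (ψ j)
    have h2 : inner ℂ (ψ j) (T (ψ j)) = (l j : ℂ) := by
      rw [h]
      simp [orthonormal_iff_ite.1 hψ, hψ.1 j]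
    rw [h2] at h1
    exact_mod_cast h1
  · have h1 := hT.2
    rw [h, trace_sum] at h1
    simp only [trace_smul, trace_rankOne, orthonormal_iff_ite.1 hψ] at h1
    simp only [if_true, mul_one] at h1
    exact_mod_cast h1

/-- A positive operator whose quadratic form vanishes on the complement of a unit vector is a
multiple of the projection onto this vector. -/
lemma eq_smul_rankOne_of_isPositive {T : K →L[ℂ] K} (hT : T.IsPositive) {ψ : K} (hψ : ‖ψ‖ = 1)
    (h : ∀ v, inner ℂ ψ v = 0 → inner ℂ v (T v) = 0) :
    ∃ c : ℂ, T = c • InnerProductSpace.rankOne ℂ ψ ψ := by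
  -- For T = ∑ |u_k⟩⟨u_k| the quadratic form is a sum of squares. Its vanishing on ψ^⊥ makes each
  -- u_k orthogonal to ψ^⊥, hence a multiple of ψ.
  obtain ⟨n, u, hu⟩ := ContinuousLinearMap.isPositive_iff_eq_sum_rankOne.1 hT
  have hψ1 : inner ℂ ψ ψ = (1 : ℂ) := by
    rw [inner_self_eq_norm_sq_to_K, hψ]
    simp
  have hquad : ∀ v, inner ℂ v (T v) = ((∑ k, ‖inner ℂ (u k) v‖ ^ 2 : ℝ) : ℂ) := by
    intro v
    rw [hu, sum_apply, inner_sum]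
    push_cast
    refine Finset.sum_congr rfl fun k _ => ?_
    rw [InnerProductSpace.rankOne_apply, inner_smul_right, ← inner_conj_symm v (u k),
      Complex.mul_conj, Complex.normSq_eq_norm_sq]
    push_cast
    rfl
  have hperp : ∀ k v, inner ℂ ψ v = 0 → inner ℂ (u k) v = (0 : ℂ) := by
    intro k v hv
    have h1 := h v hv
    rw [hquad, Complex.ofReal_eq_zero] at h1
    have h2 := (Finset.sum_eq_zero_iff_of_nonneg fun k _ => sq_nonneg _).1 h1 k (Finset.mem_univ k)
    simpa using h2
  have huk : ∀ k, u k = inner ℂ ψ (u k) • ψ := by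
    intro k
    set v := u k - inner ℂ ψ (u k) • ψ with hv
    have h1 : inner ℂ ψ v = (0 : ℂ) := by
      rw [hv, inner_sub_right, inner_smul_right, hψ1, mul_one, sub_self]
    have h2 : inner ℂ v v = (0 : ℂ) := by
      conv_lhs => rw [hv]
      rw [inner_sub_left, inner_smul_left, hperp k v h1, h1, mul_zero, sub_zero]
    exact sub_eq_zero.1 (inner_self_eq_zero.1 h2)
  refine ⟨∑ k, inner ℂ ψ (u k) * inner ℂ (u k) ψ, ?_⟩
  rw [hu, Finset.sum_smul]
  refine Finset.sum_congr rfl fun k _ => ?_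
  ext x
  simp only [smul_apply, InnerProductSpace.rankOne_apply, smul_smul]
  have h1 : inner ℂ (u k) x = inner ℂ (u k) ψ * inner ℂ ψ x := by
    conv_lhs => rw [huk k]
    rw [inner_smul_left, inner_conj_symm]
  conv_lhs => rw [h1, huk k, smul_smul]
  congr 1
  rw [← huk k]
  ring

end Spectral

/-! ### States -/

section States

variable {A : Type*} [CStarAlgebra A]

lemma mem_stateSpace_of_norm_le {ω : A →L[ℂ] ℂ} (h0 : ∀ a : A, 0 ≤ ω (star a * a)) (h1 : ω 1 = 1)
    (h2 : ‖ω‖ ≤ 1) : ω ∈ stateSpace A := by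
  have hne : (1 : A) ≠ 0 := fun h => by simp [h] at h1
  have := nontrivial_of_ne _ _ hne
  refine ⟨h0, h1, le_antisymm h2 ?_⟩
  have h3 := ω.le_opNorm 1
  rw [h1] at h3
  simpa using h3

lemma convex_stateSpace : Convex ℝ (stateSpace A) := by
  intro ω hω τ hτ s t hs ht hst
  refine mem_stateSpace_of_norm_le (fun a => ?_) ?_ ?_
  · have hs' : (0 : ℂ) ≤ s := by exact_mod_cast hs
    have ht' : (0 : ℂ) ≤ t := by exact_mod_cast ht
    have := add_nonneg (mul_nonneg hs' (hω.1 a)) (mul_nonneg ht' (hτ.1 a))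
    simpa using this
  · simp only [add_apply, smul_apply, hω.2.1, hτ.2.1,
      Complex.real_smul, mul_one]
    exact_mod_cast hst
  · refine (norm_add_le _ _).trans ?_
    rw [norm_smul, norm_smul, hω.2.2, hτ.2.2, Real.norm_of_nonneg hs, Real.norm_of_nonneg ht]
    linarith

variable [FiniteDimensional ℂ A]
variable {K : Type*} [NormedAddCommGroup K] [InnerProductSpace ℂ K] [CompleteSpace K]

/-- The functional `a ↦ ⟨ψ, σ(a) ψ⟩`. -/
def vectorState (σ : A →⋆ₐ[ℂ] (K →L[ℂ] K)) (ψ : K) : A →L[ℂ] ℂ :=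
  LinearMap.toContinuousLinearMap
    { toFun := fun a => inner ℂ ψ (σ a ψ)
      map_add' := fun a b => by simp
      map_smul' := fun c a => by simp }

lemma vectorState_apply (σ : A →⋆ₐ[ℂ] (K →L[ℂ] K)) (ψ : K) (a : A) :
    vectorState σ ψ a = inner ℂ ψ (σ a ψ) := rfl

lemma vectorState_mem_stateSpace (σ : A →⋆ₐ[ℂ] (K →L[ℂ] K)) {ψ : K} (hψ : ‖ψ‖ = 1) :
    vectorState σ ψ ∈ stateSpace A := by
  refine mem_stateSpace_of_norm_le (fun a => ?_) ?_ ?_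
  · rw [vectorState_apply, map_mul, map_star, mul_apply_eq_comp,
      ContinuousLinearMap.star_eq_adjoint, ContinuousLinearMap.adjoint_inner_right,
      inner_self_eq_norm_sq_to_K]
    simp
  · rw [vectorState_apply, map_one, one_apply_eq_self, inner_self_eq_norm_sq_to_K, hψ]
    simp
  · refine ContinuousLinearMap.opNorm_le_bound _ zero_le_one fun a => ?_
    rw [vectorState_apply, one_mul]
    calc ‖inner ℂ ψ (σ a ψ)‖ ≤ ‖ψ‖ * ‖σ a ψ‖ := norm_inner_le_norm _ _
      _ ≤ ‖ψ‖ * (‖σ a‖ * ‖ψ‖) := by gcongr; exact (σ a).le_opNorm ψ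
      _ ≤ ‖a‖ := by
        rw [hψ, one_mul, mul_one]
        exact NonUnitalStarAlgHom.norm_apply_le σ a

end States

/-! ### Families of operators that represent a functional -/

section Represented

variable {A : Type*} [CStarAlgebra A] {ι : Type*} [Fintype ι]
variable {K : ι → Type*} [∀ i, NormedAddCommGroup (K i)] [∀ i, InnerProductSpace ℂ (K i)]
  [∀ i, CompleteSpace (K i)]

/-- The functional `ω` is given by `ω(a) = ∑ᵢ Tr (Tᵢ πᵢ(a))`. -/
def RepresentedBy (rep : ∀ i, A →⋆ₐ[ℂ] (K i →L[ℂ] K i)) (ω : A →L[ℂ] ℂ)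
    (T : ∀ i, K i →L[ℂ] K i) : Prop :=
  ∀ a, ω a = ∑ i, trace (T i * rep i a)

variable {rep : ∀ i, A →⋆ₐ[ℂ] (K i →L[ℂ] K i)}
  {ω : A →L[ℂ] ℂ} {T : ∀ i, K i →L[ℂ] K i}

/-- Elements supported in one block isolate the corresponding T_i. -/
lemma RepresentedBy.apply_of_eq_single [DecidableEq ι] (h : RepresentedBy rep ω T) {i : ι}
    {X : K i →L[ℂ] K i} {a : A} (ha : ∀ j, rep j a = (Pi.single i X : ∀ j, K j →L[ℂ] K j) j) :
    ω a = trace (T i * X) := by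
  rw [h a, Finset.sum_eq_single i]
  · rw [ha, Pi.single_eq_same]
  · intro j _ hj
    rw [ha, Pi.single_eq_of_ne hj, mul_zero]
    simp [trace]
  · simp

lemma RepresentedBy.sum_trace (h : RepresentedBy rep ω T) (hω : ω 1 = 1) :
    ∑ i, trace (T i) = 1 := by
  simpa [hω, eq_comm] using h 1

lemma rankOne_mul_rankOne_self {L : Type*} [NormedAddCommGroup L] [InnerProductSpace ℂ L]
    [CompleteSpace L] (v : L) :
    star (InnerProductSpace.rankOne ℂ v v) * InnerProductSpace.rankOne ℂ v v =
      ((‖v‖ ^ 2 : ℝ) : ℂ) • InnerProductSpace.rankOne ℂ v v := by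
  rw [ContinuousLinearMap.star_eq_adjoint, InnerProductSpace.adjoint_rankOne]
  ext x
  simp only [mul_apply_eq_comp, InnerProductSpace.rankOne_apply, smul_apply,
    inner_smul_right, smul_smul, inner_self_eq_norm_sq_to_K]
  congr 1
  simp [mul_comm]

variable [∀ i, FiniteDimensional ℂ (K i)]

/-- The test element a is |v⟩⟨v| in block i and zero elsewhere: a*a is then ‖v‖² |v⟩⟨v| there, and
ω(a*a) = ‖v‖² ⟨v, T_i v⟩. -/
lemma RepresentedBy.inner_nonneg (h : RepresentedBy rep ω T)
    (hsurj : ∀ X : ∀ i, K i →L[ℂ] K i, ∃ a, ∀ i, rep i a = X i)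
    (hω : ∀ a : A, 0 ≤ ω (star a * a)) (i : ι) (v : K i) : 0 ≤ inner ℂ v (T i v) := by
  classical
  obtain ⟨a, ha⟩ := hsurj (Pi.single i (InnerProductSpace.rankOne ℂ v v))
  rcases eq_or_ne v 0 with rfl | hv
  · simp
  have h1 : ∀ j, rep j (star a * a) = (Pi.single i (((‖v‖ ^ 2 : ℝ) : ℂ) •
      InnerProductSpace.rankOne ℂ v v) : ∀ j, K j →L[ℂ] K j) j := by
    intro j
    rw [map_mul, map_star, ha]
    rcases eq_or_ne j i with rfl | hj
    · rw [Pi.single_eq_same, Pi.single_eq_same, rankOne_mul_rankOne_self]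
    · rw [Pi.single_eq_of_ne hj, Pi.single_eq_of_ne hj, mul_zero]
  have h2 := hω a
  rw [h.apply_of_eq_single h1, mul_smul_comm, trace_smul, trace_mul_rankOne] at h2
  have h3 : (0 : ℂ) < ((‖v‖ ^ 2 : ℝ) : ℂ) := by
    exact_mod_cast pow_pos (norm_pos_iff.2 hv) 2
  exact le_of_mul_le_mul_left (by simpa using h2) h3

lemma RepresentedBy.isPositive (h : RepresentedBy rep ω T)
    (hsurj : ∀ X : ∀ i, K i →L[ℂ] K i, ∃ a, ∀ i, rep i a = X i)
    (hω : ∀ a : A, 0 ≤ ω (star a * a)) (i : ι) : (T i).IsPositive := by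
  rw [ContinuousLinearMap.isPositive_iff_complex]
  intro v
  have h1 := h.inner_nonneg hsurj hω i v
  rw [Complex.nonneg_iff] at h1
  rw [← inner_conj_symm]
  constructor
  · refine Complex.ext ?_ ?_
    · simp only [RCLike.re_eq_complex_re, Complex.ofReal_re]
    · rw [Complex.ofReal_im, Complex.conj_im, ← h1.2, neg_zero]
  · rw [RCLike.re_eq_complex_re, Complex.conj_re]
    exact h1.1

variable [FiniteDimensional ℂ A]

lemma representedBy_vectorState [DecidableEq ι] (i : ι) (ψ : K i) :
    RepresentedBy rep (vectorState (rep i) ψ)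
      (Pi.single i (InnerProductSpace.rankOne ℂ ψ ψ)) := by
  intro a
  rw [Finset.sum_eq_single i]
  · rw [Pi.single_eq_same, trace_rankOne_mul, vectorState_apply]
  · intro j _ hj
    rw [Pi.single_eq_of_ne hj, zero_mul]
    simp [trace]
  · simp

lemma RepresentedBy.eq_sum_vectorState (h : RepresentedBy rep ω T) {κ : ι → Type*}
    [∀ i, Fintype (κ i)] {w : ∀ i, κ i → ℝ} {ψ : ∀ i, κ i → K i}
    (hT : ∀ i, T i = ∑ j, (w i j : ℂ) • InnerProductSpace.rankOne ℂ (ψ i j) (ψ i j)) :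
    ω = ∑ x : Σ i, κ i, w x.1 x.2 • vectorState (rep x.1) (ψ x.1 x.2) := by
  ext a
  rw [h a, Fintype.sum_sigma, sum_apply]
  refine Finset.sum_congr rfl fun i _ => ?_
  rw [hT, Finset.sum_mul, trace_sum, sum_apply]
  refine Finset.sum_congr rfl fun j _ => ?_
  rw [smul_mul_assoc, trace_smul, trace_rankOne_mul, smul_apply,
    vectorState_apply, Complex.real_smul]

/-- Every functional is represented by a family of operators if the representations
are jointly faithful. -/
lemma exists_representedBy (hinj : ∀ a, (∀ i, rep i a = 0) → a = 0)
    (ω : A →L[ℂ] ℂ) : ∃ T, RepresentedBy rep ω T := by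
  -- The trace form is nondegenerate: pairing r with r* gives ∑ Tr(π_i(r) π_i(r)*), a sum of
  -- nonnegative terms that vanish only if every π_i(r) does. In finite dimension it therefore
  -- represents every functional.
  let Φ : A →ₗ[ℂ] Module.Dual ℂ A := LinearMap.mk₂ ℂ (fun r a => ∑ i, trace (rep i r * rep i a))
    (fun r s a => by simp [add_mul, trace_add, Finset.sum_add_distrib])
    (fun c r a => by simp [trace_smul, Finset.mul_sum])
    (fun r a b => by simp [mul_add, trace_add, Finset.sum_add_distrib])
    (fun c r a => by simp [trace_smul, Finset.mul_sum])
  have hΦ : Function.Injective Φ := by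
    rw [← LinearMap.ker_eq_bot, LinearMap.ker_eq_bot']
    intro r hr
    refine hinj r fun i => ?_
    have h1 : ∑ i, trace (rep i r * rep i (star r)) = 0 := congr($hr (star r))
    have hpos : ∀ i, 0 ≤ trace (rep i r * rep i (star r)) := by
      intro i
      have h2 : (rep i r * rep i (star r)).IsPositive := by
        rw [map_star, ← ContinuousLinearMap.nonneg_iff_isPositive]
        exact mul_star_self_nonneg _
      exact h2.toLinearMap.trace_nonneg
    have h2 := (Finset.sum_eq_zero_iff_of_nonneg fun i _ => hpos i).1 h1 i (Finset.mem_univ i)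
    rw [map_star] at h2
    exact eq_zero_of_trace_mul_star_eq_zero h2
  have hsurj : Function.Surjective Φ :=
    (LinearMap.injective_iff_surjective_of_finrank_eq_finrank
      (Subspace.dual_finrank_eq).symm).1 hΦ
  obtain ⟨r, hr⟩ := hsurj ω
  exact ⟨fun i => rep i r, fun a => congr($hr a).symm⟩

end Represented

/-! ### Pure states -/

section Pure

variable {A : Type*} [CStarAlgebra A] [FiniteDimensional ℂ A] {ι : Type*} [Fintype ι]
variable {K : ι → Type*} [∀ i, NormedAddCommGroup (K i)] [∀ i, InnerProductSpace ℂ (K i)]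
  [∀ i, CompleteSpace (K i)] [∀ i, FiniteDimensional ℂ (K i)]
  {rep : ∀ i, A →⋆ₐ[ℂ] (K i →L[ℂ] K i)}

/-- If a mixture of two states is the vector state of ψ, the positive operators of each component
vanish, as quadratic forms, wherever that of |ψ⟩⟨ψ| does. So those of τ₁ are zero off block i and c
|ψ⟩⟨ψ| in it, with c = 1 by normalization. -/
lemma vectorState_mem_pureStates (hinj : ∀ a, (∀ i, rep i a = 0) → a = 0)
    (hsurj : ∀ X : ∀ i, K i →L[ℂ] K i, ∃ a, ∀ i, rep i a = X i) (i : ι) {ψ : K i}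
    (hψ : ‖ψ‖ = 1) : vectorState (rep i) ψ ∈ pureStates A := by
  classical
  refine ⟨vectorState_mem_stateSpace (rep i) hψ, ?_⟩
  rintro τ₁ hτ₁ τ₂ hτ₂ ⟨s, t, hs, ht, hst, h⟩
  obtain ⟨T₁, hT₁⟩ := exists_representedBy hinj τ₁
  obtain ⟨T₂, hT₂⟩ := exists_representedBy hinj τ₂
  have hpos₁ := hT₁.isPositive hsurj hτ₁.1
  have hpos₂ := hT₂.isPositive hsurj hτ₂.1
  have hquad : ∀ j (v : K j), inner ℂ v ((Pi.single i (InnerProductSpace.rankOne ℂ ψ ψ) :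
      ∀ j, K j →L[ℂ] K j) j v) = 0 → inner ℂ v (T₁ j v) = (0 : ℂ) := by
    intro j v hv
    obtain ⟨a, ha⟩ := hsurj (Pi.single j (InnerProductSpace.rankOne ℂ v v))
    have h0 := (representedBy_vectorState (rep := rep) i ψ).apply_of_eq_single ha
    have h1 := hT₁.apply_of_eq_single ha
    have h2 := hT₂.apply_of_eq_single ha
    rw [trace_mul_rankOne] at h0 h1 h2
    have h3 := congr($h a)
    rw [add_apply, smul_apply, smul_apply, h0, h1, h2, hv, Complex.real_smul,
      Complex.real_smul] at h3
    have hs' : (0 : ℂ) < s := Complex.zero_lt_real.2 hs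
    have ht' : (0 : ℂ) < t := Complex.zero_lt_real.2 ht
    have h4 := (add_eq_zero_iff_of_nonneg
      (mul_nonneg hs'.le ((hpos₁ j).inner_nonneg_right v))
      (mul_nonneg ht'.le ((hpos₂ j).inner_nonneg_right v))).1 h3
    exact (mul_eq_zero.1 h4.1).resolve_left hs'.ne'
  have hoff : ∀ j, j ≠ i → T₁ j = 0 := by
    intro j hj
    have h1 : (T₁ j : K j →ₗ[ℂ] K j) = 0 := by
      rw [← inner_map_self_eq_zero]
      intro v
      rw [← inner_conj_symm]
      refine (map_eq_zero _).2 (hquad j v ?_)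
      rw [Pi.single_eq_of_ne hj]
      simp
    exact ContinuousLinearMap.coe_injective h1
  obtain ⟨c, hc⟩ := eq_smul_rankOne_of_isPositive (hpos₁ i) hψ fun v hv => hquad i v (by
    rw [Pi.single_eq_same, InnerProductSpace.rankOne_apply, hv, zero_smul, inner_zero_right])
  have hc1 : c = 1 := by
    have h1 := hT₁.sum_trace hτ₁.2.1
    rw [Finset.sum_eq_single i (fun j _ hj => by rw [hoff j hj]; simp [trace]) (by simp), hc,
      trace_smul, trace_rankOne, inner_self_eq_norm_sq_to_K, hψ] at h1
    simpa using h1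
  have hT : T₁ = Pi.single i (InnerProductSpace.rankOne ℂ ψ ψ) := by
    funext j
    rcases eq_or_ne j i with rfl | hj
    · rw [Pi.single_eq_same, hc, hc1, one_smul]
    · rw [Pi.single_eq_of_ne hj, hoff j hj]
  ext a
  rw [hT₁ a, hT, ← representedBy_vectorState i ψ a]

/-- Spectral decomposition shows that the state space is the convex hull of the vector states, and
extreme points of a convex hull lie in the generating set. -/
lemma exists_eq_vectorState_of_mem_pureStates (hinj : ∀ a, (∀ i, rep i a = 0) → a = 0)
    (hsurj : ∀ X : ∀ i, K i →L[ℂ] K i, ∃ a, ∀ i, rep i a = X i) {τ : A →L[ℂ] ℂ}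
    (hτ : τ ∈ pureStates A) : ∃ (i : ι) (ψ : K i), ‖ψ‖ = 1 ∧ τ = vectorState (rep i) ψ := by
  set V : Set (A →L[ℂ] ℂ) := {τ | ∃ (i : ι) (ψ : K i), ‖ψ‖ = 1 ∧ τ = vectorState (rep i) ψ} with hV
  have hsub : V ⊆ stateSpace A := by
    rintro _ ⟨i, ψ, hψ, rfl⟩
    exact vectorState_mem_stateSpace (rep i) hψ
  have hhull : stateSpace A = convexHull ℝ V := by
    refine Set.Subset.antisymm (fun ω hω => ?_) (convexHull_min hsub convex_stateSpace)
    obtain ⟨T, hT⟩ := exists_representedBy hinj ω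
    choose l b hl hb hTl using fun i =>
      exists_spectral_decomposition (hT.isPositive hsurj hω.1 i)
    rw [hT.eq_sum_vectorState hTl]
    refine (convex_convexHull ℝ V).sum_mem (fun x _ => hl x.1 x.2) ?_ fun x _ =>
      subset_convexHull ℝ V ⟨x.1, b x.1 x.2, (b x.1).orthonormal.1 x.2, rfl⟩
    have h1 := hT.sum_trace hω.2.1
    rw [Fintype.sum_sigma]
    have h2 : ∀ i, trace (T i) = ((∑ j, l i j : ℝ) : ℂ) := by
      intro i
      rw [trace_eq_sum_of_eigenbasis (b i).toBasis (T i) (fun j => (l i j : ℂ))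
        (fun j => by simpa using hb i j)]
      push_cast
      rfl
    simp only [h2] at h1
    exact_mod_cast h1
  rw [pureStates, hhull] at hτ
  have h : τ ∈ V := extremePoints_convexHull_subset hτ
  exact h

end Pure

/-! ### The optimal decomposition of a state -/

section Optimal

/-- Collecting the blocks in the multiplicity-free space ⨁ K_i makes the comparison of mixtures in a
single Hilbert space applicable. -/
lemma orthonormal_piLpSingle {ι : Type*} [Fintype ι] [DecidableEq ι] {K : ι → Type*}
    [∀ i, NormedAddCommGroup (K i)] [∀ i, InnerProductSpace ℂ (K i)] {κ : ι → Type*}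
    {ψ : ∀ i, κ i → K i} (hψ : ∀ i, Orthonormal ℂ (ψ i)) :
    Orthonormal ℂ fun x : Σ i, κ i =>
      PiLp.single 2 x.1 (ψ x.1 x.2) := by
  classical
  rw [orthonormal_iff_ite]
  rintro ⟨i, j⟩ ⟨i', j'⟩
  rw [PiLp.inner_apply, Finset.sum_eq_single i]
  · rcases eq_or_ne i i' with rfl | hi
    · simp [orthonormal_iff_ite.1 (hψ i)]
    · simp [hi]
  · intro k _ hk
    simp [hk]
  · simp

lemma inner_piLpSingle_left {ι : Type*} [Fintype ι] [DecidableEq ι] {K : ι → Type*}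
    [∀ i, NormedAddCommGroup (K i)] [∀ i, InnerProductSpace ℂ (K i)] (i : ι) (φ : K i)
    (v : PiLp 2 K) :
    inner ℂ (PiLp.single 2 i φ) v = inner ℂ φ (v i) := by
  rw [PiLp.inner_apply, Finset.sum_eq_single i]
  · simp
  · intro k _ hk
    simp [hk]
  · simp

lemma vectorState_apply_rankOne {A : Type*} [CStarAlgebra A] [FiniteDimensional ℂ A] {K : Type*}
    [NormedAddCommGroup K] [InnerProductSpace ℂ K] [CompleteSpace K] {σ : A →⋆ₐ[ℂ] (K →L[ℂ] K)}
    (φ : K) {v : K} {a : A} (ha : σ a = InnerProductSpace.rankOne ℂ v v) :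
    vectorState σ φ a = ((‖inner ℂ φ v‖ ^ 2 : ℝ) : ℂ) := by
  rw [vectorState_apply, ha, InnerProductSpace.rankOne_apply, inner_smul_right,
    ← inner_conj_symm v φ, mul_comm, Complex.mul_conj, Complex.normSq_eq_norm_sq]

variable {A : Type*} [CStarAlgebra A] [FiniteDimensional ℂ A] {ι : Type*} [Fintype ι]
variable {K : ι → Type*} [∀ i, NormedAddCommGroup (K i)] [∀ i, InnerProductSpace ℂ (K i)]
  [∀ i, CompleteSpace (K i)] [∀ i, FiniteDimensional ℂ (K i)]
  {rep : ∀ i, A →⋆ₐ[ℂ] (K i →L[ℂ] K i)}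

/-- A decomposition of a state into vector states along orthonormal families minimizes the
Shannon entropy. -/
lemma isLeast_decompositionEntropies (hinj : ∀ a, (∀ i, rep i a = 0) → a = 0)
    (hsurj : ∀ X : ∀ i, K i →L[ℂ] K i, ∃ a, ∀ i, rep i a = X i) {ω : A →L[ℂ] ℂ}
    {κ : ι → Type*} [∀ i, Fintype (κ i)] {w : (Σ i, κ i) → ℝ} (hw : w ∈ stdSimplex ℝ (Σ i, κ i))
    {ψ : ∀ i, κ i → K i} (hψ : ∀ i, Orthonormal ℂ (ψ i))
    (hω : ω = ∑ x : Σ i, κ i, w x • vectorState (rep x.1) (ψ x.1 x.2)) :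
    IsLeast (decompositionEntropies ω) (shannonEntropy w) := by
  classical
  constructor
  · let e := (Fintype.equivFin (Σ i, κ i)).symm
    refine ⟨Fintype.card (Σ i, κ i), w ∘ e,
      fun k => vectorState (rep (e k).1) (ψ (e k).1 (e k).2), ⟨fun k => hw.1 _, ?_⟩,
      fun k => vectorState_mem_pureStates hinj hsurj _ ((hψ _).1 _), ?_,
      (shannonEntropy_comp_equiv e w).symm⟩
    · rw [← hw.2]
      exact e.sum_comp w
    · rw [hω]
      exact (e.sum_comp fun x => w x • vectorState (rep x.1) (ψ x.1 x.2)).symm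
  · rintro _ ⟨n, q, τ, hq, hτ, hωq, rfl⟩
    choose i φ hφ hτφ using fun k => exists_eq_vectorState_of_mem_pureStates hinj hsurj (hτ k)
    refine shannonEntropy_le_of_mixture hw.1 hq.1 (orthonormal_piLpSingle hψ)
      (φ := fun k => PiLp.single 2 (i k) (φ k)) (fun k => ?_) fun v => ?_
    · rw [PiLp.norm_single, hφ]
    · obtain ⟨a, ha⟩ := hsurj fun i => InnerProductSpace.rankOne ℂ (v i) (v i)
      have h1 := congr($hω a)
      rw [hωq] at h1
      simp only [sum_apply, smul_apply, hτφ, vectorState_apply_rankOne _ (ha _),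
        Complex.real_smul] at h1
      simp only [inner_piLpSingle_left]
      exact_mod_cast h1

end Optimal

/-! ### The representative of a state -/

section Representative

variable {A : Type*} [CStarAlgebra A]
variable {H : Type*} [NormedAddCommGroup H] [InnerProductSpace ℂ H] [FiniteDimensional ℂ H]
  [CompleteSpace H]

/-- The difference S of two representatives lies in π(A), so S* is itself an admissible test
operator; this gives Tr(S S*) = 0. -/
lemma IsRepresentative.unique {π : A →⋆ₐ[ℂ] (H →L[ℂ] H)} {ω : A →L[ℂ] ℂ} {ρ ρ' : H →L[ℂ] H}
    (h : IsRepresentative π ω ρ) (h' : IsRepresentative π ω ρ') : ρ = ρ' := by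
  obtain ⟨⟨r, rfl⟩, -, hr⟩ := h
  obtain ⟨⟨r', rfl⟩, -, hr'⟩ := h'
  rw [← sub_eq_zero]
  refine eq_zero_of_trace_mul_star_eq_zero ?_
  rw [← map_sub, ← map_star, map_sub π r r', sub_mul, trace_sub, ← hr, ← hr', sub_self]

variable {ι : Type*} [Fintype ι]
variable {K : ι → Type*} [∀ i, NormedAddCommGroup (K i)] [∀ i, InnerProductSpace ℂ (K i)]
  [∀ i, FiniteDimensional ℂ (K i)] [∀ i, CompleteSpace (K i)] {m : ι → ℕ}
  {π : A →⋆ₐ[ℂ] (H →L[ℂ] H)} (D : IrreducibleDecomposition π K m)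

lemma IrreducibleDecomposition.rep_jointly_injective (hπ : Function.Injective π) (a : A)
    (ha : ∀ i, D.rep i a = 0) : a = 0 := by
  refine hπ ?_
  rw [D.map_eq, D.map_eq]
  simp [ha]

lemma IrreducibleDecomposition.exists_rep_eq (X : ∀ i, K i →L[ℂ] K i) :
    ∃ a, ∀ i, D.rep i a = X i :=
  exists_forall_rep_eq D.rep D.irreducible D.inequivalent X

/-- The factor 1/m_i offsets the trace over ℂ^{m_i}. Factoring each block as S_i* S_i and lifting
the S_i to one s in the algebra exhibits the operator as π(s*s), so it is positive and in the range
at once. -/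
lemma IrreducibleDecomposition.isRepresentative {ω : A →L[ℂ] ℂ} {T : ∀ i, K i →L[ℂ] K i}
    (h : RepresentedBy D.rep ω T) (hpos : ∀ i, (T i).IsPositive) (htr : ∑ i, trace (T i) = 1) :
    IsRepresentative π ω (blockOp D.U fun i => ((1 / m i : ℝ) : ℂ) • T i) := by
  have hm : ∀ i, (m i : ℂ) ≠ 0 := fun i => Nat.cast_ne_zero.2 (D.mult_pos i).ne'
  have hcancel : ∀ i (c : ℂ), (m i : ℂ) * (((1 / m i : ℝ) : ℂ) * c) = c := by
    intro i c
    push_cast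
    field_simp [hm i]
  have hroot : ∀ i, ∃ S : K i →L[ℂ] K i, ((1 / m i : ℝ) : ℂ) • T i = star S * S := by
    intro i
    refine CStarAlgebra.nonneg_iff_eq_star_mul_self.1 ?_
    rw [ContinuousLinearMap.nonneg_iff_isPositive]
    exact (hpos i).smul_of_nonneg (Complex.zero_le_real.2 (by positivity))
  choose S hS using hroot
  obtain ⟨s, hs⟩ := D.exists_rep_eq S
  have hρ : blockOp D.U (fun i => ((1 / m i : ℝ) : ℂ) • T i) = π (star s * s) := by
    rw [D.map_eq]
    congr 1
    funext i
    rw [map_mul, map_star, hs, hS]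
  refine ⟨⟨_, hρ.symm⟩, ⟨?_, ?_⟩, fun a => ?_⟩
  · rw [hρ, map_mul, map_star, ← ContinuousLinearMap.nonneg_iff_isPositive]
    exact star_mul_self_nonneg _
  · rw [trace_blockOp, ← htr]
    exact Finset.sum_congr rfl fun i _ => by rw [trace_smul, hcancel]
  · rw [D.map_eq, blockOp_mul, trace_blockOp, h a]
    exact Finset.sum_congr rfl fun i _ => by rw [smul_mul_assoc, trace_smul, hcancel]

/-- Here the multiplicities drop out, which is why the entropy of the state does not depend on them.
-/
lemma IrreducibleDecomposition.representedBy_of_isRepresentative {ω : A →L[ℂ] ℂ} {p : ι → ℝ}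
    {σ : ∀ i, K i →L[ℂ] K i} (h : IsRepresentative π ω (canonicalOp D.U p σ)) :
    RepresentedBy D.rep ω fun i => (p i : ℂ) • σ i := by
  intro a
  rw [h.2.2 a, canonicalOp, D.map_eq, blockOp_mul, trace_blockOp]
  refine Finset.sum_congr rfl fun i _ => ?_
  have hm : (m i : ℂ) ≠ 0 := Nat.cast_ne_zero.2 (D.mult_pos i).ne'
  rw [smul_mul_assoc, smul_mul_assoc, trace_smul, trace_smul]
  push_cast
  field_simp

lemma exists_isDensity (L : Type*) [NormedAddCommGroup L] [InnerProductSpace ℂ L]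
    [FiniteDimensional ℂ L] [Nontrivial L] : ∃ T : L →L[ℂ] L, IsDensity T := by
  obtain ⟨ψ, hψ⟩ := exists_norm_eq L zero_le_one
  refine ⟨InnerProductSpace.rankOne ℂ ψ ψ, InnerProductSpace.isPositive_rankOne_self ψ, ?_⟩
  rw [trace_rankOne, inner_self_eq_norm_sq_to_K, hψ]
  simp

lemma exists_eq_smul_isDensity_of_isPositive {L : Type*} [NormedAddCommGroup L]
    [InnerProductSpace ℂ L] [FiniteDimensional ℂ L] [Nontrivial L] {T : L →L[ℂ] L}
    (hT : T.IsPositive) : ∃ p : ℝ, 0 ≤ p ∧ trace T = p ∧ ∃ σ, IsDensity σ ∧ T = (p : ℂ) • σ := by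
  have h0 : 0 ≤ trace T := hT.toLinearMap.trace_nonneg
  have hre : trace T = ((trace T).re : ℂ) := Complex.eq_re_of_ofReal_le h0
  refine ⟨(trace T).re, (Complex.nonneg_iff.1 h0).1, hre, ?_⟩
  rcases eq_or_ne (trace T) 0 with h | h
  -- A block of weight zero has T = 0, and any density matrix can stand for σ.
  · obtain ⟨σ, hσ⟩ := exists_isDensity L
    exact ⟨σ, hσ, by rw [eq_zero_of_isPositive_of_trace_eq_zero hT h]; simp [trace]⟩
  · refine ⟨((trace T).re : ℂ)⁻¹ • T, ⟨hT.smul_of_nonneg ?_, ?_⟩, ?_⟩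
    · rw [← Complex.ofReal_inv]
      exact Complex.zero_le_real.2 (inv_nonneg.2 (Complex.nonneg_iff.1 h0).1)
    · rw [trace_smul, ← hre, inv_mul_cancel₀ h]
    · rw [smul_smul, ← hre, mul_inv_cancel₀ h, one_smul]

lemma IrreducibleDecomposition.exists_canonicalOp {T : ∀ i, K i →L[ℂ] K i}
    (hpos : ∀ i, (T i).IsPositive) (htr : ∑ i, trace (T i) = 1) :
    ∃ p ∈ stdSimplex ℝ ι, ∃ σ : ∀ i, K i →L[ℂ] K i, (∀ i, IsDensity (σ i)) ∧
      blockOp D.U (fun i => ((1 / m i : ℝ) : ℂ) • T i) = canonicalOp D.U p σ := by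
  have : ∀ i, Nontrivial (K i) := fun i => (D.irreducible i).1
  choose p hp hpT σ hσ hT using fun i => exists_eq_smul_isDensity_of_isPositive (hpos i)
  refine ⟨p, ⟨hp, ?_⟩, σ, hσ, ?_⟩
  · simp only [hpT] at htr
    exact_mod_cast htr
  · rw [canonicalOp]
    congr 1
    funext i
    rw [hT, smul_smul, ← Complex.ofReal_mul]
    congr 2
    ring

lemma shannonEntropy_const_mul {κ : Type*} [Fintype κ] (c : ℝ) {l : κ → ℝ} (hl : ∑ j, l j = 1) :
    shannonEntropy (fun j => c * l j) = Real.negMulLog c + c * shannonEntropy l := by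
  simp only [shannonEntropy_eq_sum_negMulLog, Real.negMulLog_mul, Finset.sum_add_distrib,
    ← Finset.sum_mul, hl, one_mul, ← Finset.mul_sum]

lemma exists_spectral_isDensity {L : Type*} [NormedAddCommGroup L] [InnerProductSpace ℂ L]
    [FiniteDimensional ℂ L] [CompleteSpace L] {T : L →L[ℂ] L} (hT : IsDensity T) :
    ∃ (l : Fin (Module.finrank ℂ L) → ℝ) (b : OrthonormalBasis (Fin (Module.finrank ℂ L)) ℂ L),
      (∀ j, T (b j) = (l j : ℂ) • b j) ∧
      T = ∑ j, (l j : ℂ) • InnerProductSpace.rankOne ℂ (b j) (b j) ∧ ∑ j, l j = 1 ∧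
      vonNeumannEntropy T = shannonEntropy l := by
  obtain ⟨l, b, -, hb, h⟩ := exists_spectral_decomposition hT.1
  exact ⟨l, b, hb, h, (hT.sum_eigenvalues b.orthonormal h).2,
    vonNeumannEntropy_eq_of_eigenbasis b.toBasis hT.1.isSelfAdjoint l
      (fun j => by simpa using hb j)⟩

/-- Block i contributes m_i copies of the entropy of (p_i λ_j / m_i)_j, and −m_i (p_i/m_i) log
(p_i/m_i) = −p_i log p_i + p_i log m_i. -/
lemma vonNeumannEntropy_canonicalOp (U : H ≃ₗᵢ[ℂ] BlockSpace K m) (hm : ∀ i, 0 < m i) {p : ι → ℝ}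
    {σ : ∀ i, K i →L[ℂ] K i} (hσ : ∀ i, IsDensity (σ i))
    (hρ : IsSelfAdjoint (canonicalOp U p σ)) :
    vonNeumannEntropy (canonicalOp U p σ) =
      shannonEntropy p + ∑ i, p i * vonNeumannEntropy (σ i) + ∑ i, p i * Real.log (m i) := by
  choose l b hb _ hl hvN using fun i => exists_spectral_isDensity (hσ i)
  rw [canonicalOp, vonNeumannEntropy_blockOp U (fun i => (b i).toBasis) _ hρ
    (fun i j => p i / m i * l i j) fun i j => ?_]
  · rw [shannonEntropy_eq_sum_negMulLog p, ← Finset.sum_add_distrib, ← Finset.sum_add_distrib]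
    refine Finset.sum_congr rfl fun i _ => ?_
    have hmi : (m i : ℝ) ≠ 0 := Nat.cast_ne_zero.2 (hm i).ne'
    rw [shannonEntropy_const_mul _ (hl i), hvN, Real.negMulLog, Real.negMulLog]
    rcases eq_or_ne (p i) 0 with h0 | h0
    · simp [h0]
    · rw [Real.log_div h0 hmi]
      field_simp
      ring
  · simp only [OrthonormalBasis.coe_toBasis, smul_apply, hb, smul_smul]
    push_cast
    rfl

variable [FiniteDimensional ℂ A]

lemma RepresentedBy.spectral {rep : ∀ i, A →⋆ₐ[ℂ] (K i →L[ℂ] K i)}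
    (hinj : ∀ a, (∀ i, rep i a = 0) → a = 0)
    (hsurj : ∀ X : ∀ i, K i →L[ℂ] K i, ∃ a, ∀ i, rep i a = X i) {ω : A →L[ℂ] ℂ} {p : ι → ℝ}
    (hp : p ∈ stdSimplex ℝ ι) {σ : ∀ i, K i →L[ℂ] K i} (hσ : ∀ i, IsDensity (σ i))
    (h : RepresentedBy rep ω fun i => (p i : ℂ) • σ i) {κ : ι → Type*} [∀ i, Fintype (κ i)]
    {l : ∀ i, κ i → ℝ} {ψ : ∀ i, κ i → K i} (hψ : ∀ i, Orthonormal ℂ (ψ i))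
    (hl : ∀ i, σ i = ∑ j, (l i j : ℂ) • InnerProductSpace.rankOne ℂ (ψ i j) (ψ i j)) :
    (fun x : Σ i, κ i => p x.1 * l x.1 x.2) ∈ stdSimplex ℝ (Σ i, κ i) ∧
    ω = ∑ x : Σ i, κ i, (p x.1 * l x.1 x.2) • vectorState (rep x.1) (ψ x.1 x.2) ∧
    IsLeast (decompositionEntropies ω)
      (shannonEntropy fun x : Σ i, κ i => p x.1 * l x.1 x.2) := by
  have hs := fun i => (hσ i).sum_eigenvalues (hψ i) (hl i)
  have h1 : (fun x : Σ i, κ i => p x.1 * l x.1 x.2) ∈ stdSimplex ℝ (Σ i, κ i) := by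
    refine ⟨fun x => mul_nonneg (hp.1 _) ((hs _).1 _), ?_⟩
    rw [Fintype.sum_sigma, ← hp.2]
    refine Finset.sum_congr rfl fun i _ => ?_
    change ∑ j, p i * l i j = p i
    rw [← Finset.mul_sum, (hs i).2, mul_one]
  have h2 : ω = ∑ x : Σ i, κ i, (p x.1 * l x.1 x.2) • vectorState (rep x.1) (ψ x.1 x.2) := by
    refine h.eq_sum_vectorState (w := fun i j => p i * l i j) fun i => ?_
    rw [hl, Finset.smul_sum]
    refine Finset.sum_congr rfl fun j _ => ?_
    rw [smul_smul, Complex.ofReal_mul]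
  exact ⟨h1, h2, isLeast_decompositionEntropies hinj hsurj h1 hψ h2⟩

lemma RepresentedBy.stateEntropy_eq {rep : ∀ i, A →⋆ₐ[ℂ] (K i →L[ℂ] K i)}
    (hinj : ∀ a, (∀ i, rep i a = 0) → a = 0)
    (hsurj : ∀ X : ∀ i, K i →L[ℂ] K i, ∃ a, ∀ i, rep i a = X i) {ω : A →L[ℂ] ℂ} {p : ι → ℝ}
    (hp : p ∈ stdSimplex ℝ ι) {σ : ∀ i, K i →L[ℂ] K i} (hσ : ∀ i, IsDensity (σ i))
    (h : RepresentedBy rep ω fun i => (p i : ℂ) • σ i) :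
    stateEntropy ω = shannonEntropy p + ∑ i, p i * vonNeumannEntropy (σ i) := by
  choose l b hb hσl hl hvN using fun i => exists_spectral_isDensity (hσ i)
  obtain ⟨-, -, hleast⟩ := h.spectral hinj hsurj hp hσ (fun i => (b i).orthonormal) hσl
  rw [stateEntropy, hleast.csInf_eq, shannonEntropy_sigma p l hl]
  simp only [hvN]

/-- The state `a ↦ ⟨ψ, πᵢ(a) ψ⟩` is represented by the normalized block operator of `ψ`. -/
lemma IrreducibleDecomposition.isRepresentative_pureBlock [DecidableEq ι] (i : ι) {ψ : K i}
    (hψ : ‖ψ‖ = 1) :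
    IsRepresentative π (vectorState (D.rep i) ψ) (pureBlock D.U i ψ) := by
  have hT := representedBy_vectorState (rep := D.rep) i ψ
  have h := D.isRepresentative hT
    (hT.isPositive D.exists_rep_eq (vectorState_mem_stateSpace (D.rep i) hψ).1)
    (hT.sum_trace (vectorState_mem_stateSpace (D.rep i) hψ).2.1)
  convert h using 1
  rw [pureBlock]
  congr 1
  funext j
  rcases eq_or_ne j i with rfl | hj
  · rw [Pi.single_eq_same, Pi.single_eq_same]
  · rw [Pi.single_eq_of_ne hj, Pi.single_eq_of_ne hj, smul_zero]

lemma IrreducibleDecomposition.exists_isRepresentative (hπ : Function.Injective π)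
    {ω : A →L[ℂ] ℂ} (hω : ω ∈ stateSpace A) :
    ∃ ρ, IsRepresentative π ω ρ ∧ ∃ p ∈ stdSimplex ℝ ι, ∃ σ : ∀ i, K i →L[ℂ] K i,
      (∀ i, IsDensity (σ i)) ∧ ρ = canonicalOp D.U p σ := by
  obtain ⟨T, hT⟩ := exists_representedBy (D.rep_jointly_injective hπ) ω
  have hpos := hT.isPositive D.exists_rep_eq hω.1
  have htr := hT.sum_trace hω.2.1
  exact ⟨_, D.isRepresentative hT hpos htr, D.exists_canonicalOp hpos htr⟩

lemma sum_mul_log_eq_zero_iff {p : ι → ℝ} (hp : ∀ i, 0 ≤ p i) (hm : ∀ i, 0 < m i) :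
    ∑ i, p i * Real.log (m i) = 0 ↔ ∀ i, p i ≠ 0 → m i = 1 := by
  have h1 : ∀ i, (1 : ℝ) ≤ m i := fun i => by exact_mod_cast hm i
  rw [Finset.sum_eq_zero_iff_of_nonneg fun i _ => mul_nonneg (hp i) (Real.log_nonneg (h1 i))]
  refine forall_congr' fun i => ?_
  rw [mul_eq_zero, or_iff_not_imp_left]
  simp only [Finset.mem_univ, true_imp_iff]
  refine imp_congr_right fun _ => ⟨fun h => ?_, fun h => by simp [h]⟩
  rw [Real.log_eq_zero] at h
  have := h1 i
  rcases h with h | h | h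
  · linarith
  · exact_mod_cast h
  · linarith

end Representative

end CStarEntropy

end

/-! ### Entropy formulas and the multiplicity-free criterion -/

theorem mainTheorem3
    {A : Type*} [CStarAlgebra A] [FiniteDimensional ℂ A]
    {H : Type*} [NormedAddCommGroup H] [InnerProductSpace ℂ H] [FiniteDimensional ℂ H]
    [CompleteSpace H]
    {ι : Type*} [Fintype ι] [DecidableEq ι]
    {K : ι → Type*} [∀ i, NormedAddCommGroup (K i)] [∀ i, InnerProductSpace ℂ (K i)]
    [∀ i, FiniteDimensional ℂ (K i)] [∀ i, CompleteSpace (K i)]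
    {m : ι → ℕ} (π : A →⋆ₐ[ℂ] (H →L[ℂ] H)) (hπ : Function.Injective π)
    (D : CStarEntropy.IrreducibleDecomposition π K m) :
    (∀ ω ∈ CStarEntropy.stateSpace A,
      (∃! ρ : H →L[ℂ] H, CStarEntropy.IsRepresentative π ω ρ) ∧
      ∀ ρ : H →L[ℂ] H, CStarEntropy.IsRepresentative π ω ρ →
        -- the canonical decomposition of the representative exists
        (∃ p ∈ stdSimplex ℝ ι, ∃ σ : ∀ i, K i →L[ℂ] K i,
          (∀ i, CStarEntropy.IsDensity (σ i)) ∧ ρ = CStarEntropy.canonicalOp D.U p σ) ∧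
        -- and for every such decomposition:
        (∀ p ∈ stdSimplex ℝ ι, ∀ σ : ∀ i, K i →L[ℂ] K i,
          (∀ i, CStarEntropy.IsDensity (σ i)) → ρ = CStarEntropy.canonicalOp D.U p σ →
            CStarEntropy.stateEntropy ω =
              CStarEntropy.shannonEntropy p
                + ∑ i, p i * CStarEntropy.vonNeumannEntropy (σ i) ∧
            -- the combined spectral decomposition attains the infimum
            (∀ (n : ι → ℕ) (lam : ∀ i, Fin (n i) → ℝ) (ψ : ∀ i, Fin (n i) → K i),
              (∀ i, Orthonormal ℂ (ψ i)) →
              (∀ i, σ i =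
                ∑ j, ((lam i j : ℝ) : ℂ) • InnerProductSpace.rankOne ℂ (ψ i j) (ψ i j)) →
              (fun x : Σ i, Fin (n i) => p x.1 * lam x.1 x.2) ∈
                  stdSimplex ℝ (Σ i, Fin (n i)) ∧
              (∃ τ : (Σ i, Fin (n i)) → (A →L[ℂ] ℂ),
                (∀ x, τ x ∈ CStarEntropy.pureStates A ∧
                  CStarEntropy.IsRepresentative π (τ x)
                    (CStarEntropy.pureBlock D.U x.1 (ψ x.1 x.2))) ∧
                ω = ∑ x, (p x.1 * lam x.1 x.2) • τ x) ∧
              IsLeast (CStarEntropy.decompositionEntropies ω)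
                (CStarEntropy.shannonEntropy
                  fun x : Σ i, Fin (n i) => p x.1 * lam x.1 x.2)) ∧
            CStarEntropy.vonNeumannEntropy ρ =
              CStarEntropy.stateEntropy ω + ∑ i, p i * Real.log (m i) ∧
            (CStarEntropy.vonNeumannEntropy ρ = CStarEntropy.stateEntropy ω ↔
              ∀ i, p i ≠ 0 → m i = 1))) ∧
    -- the two entropies agree on all states iff the representation is multiplicity-free
    ((∀ ω ∈ CStarEntropy.stateSpace A, ∀ ρ : H →L[ℂ] H,
        CStarEntropy.IsRepresentative π ω ρ →
          CStarEntropy.vonNeumannEntropy ρ = CStarEntropy.stateEntropy ω) ↔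
      ∀ i, m i = 1) := by
  have hinj := D.rep_jointly_injective hπ
  have hsurj := D.exists_rep_eq
  have hvN : ∀ ω : A →L[ℂ] ℂ, ∀ p ∈ stdSimplex ℝ ι, ∀ σ : ∀ i, K i →L[ℂ] K i,
      (∀ i, CStarEntropy.IsDensity (σ i)) →
      CStarEntropy.IsRepresentative π ω (CStarEntropy.canonicalOp D.U p σ) →
      CStarEntropy.stateEntropy ω = CStarEntropy.shannonEntropy p
        + ∑ i, p i * CStarEntropy.vonNeumannEntropy (σ i) ∧
      CStarEntropy.vonNeumannEntropy (CStarEntropy.canonicalOp D.U p σ) =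
        CStarEntropy.stateEntropy ω + ∑ i, p i * Real.log (m i) ∧
      (CStarEntropy.vonNeumannEntropy (CStarEntropy.canonicalOp D.U p σ) =
        CStarEntropy.stateEntropy ω ↔ ∀ i, p i ≠ 0 → m i = 1) := by
    intro ω p hp σ hσ hρ
    have h1 := (D.representedBy_of_isRepresentative hρ).stateEntropy_eq hinj hsurj hp hσ
    have h2 := CStarEntropy.vonNeumannEntropy_canonicalOp D.U D.mult_pos (p := p) hσ
      hρ.2.1.1.isSelfAdjoint
    rw [← h1] at h2
    refine ⟨h1, h2, ?_⟩
    rw [h2, add_eq_left]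
    exact CStarEntropy.sum_mul_log_eq_zero_iff hp.1 D.mult_pos
  refine ⟨fun ω hω => ?_, fun h i => ?_, fun h ω hω ρ hρ => ?_⟩
  · obtain ⟨ρ, hρ, hcan⟩ := D.exists_isRepresentative hπ hω
    refine ⟨⟨ρ, hρ, fun ρ' hρ' => hρ'.unique hρ⟩, fun ρ' hρ' => ?_⟩
    obtain rfl := hρ'.unique hρ
    refine ⟨hcan, ?_⟩
    rintro p hp σ hσ rfl
    obtain ⟨h1, h2, h3⟩ := hvN ω p hp σ hσ hρ
    refine ⟨h1, fun n lam ψ hψ hlam => ?_, h2, h3⟩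
    obtain ⟨h4, h5, h6⟩ :=
      (D.representedBy_of_isRepresentative hρ).spectral hinj hsurj hp hσ hψ hlam
    exact ⟨h4, ⟨_, fun x => ⟨CStarEntropy.vectorState_mem_pureStates hinj hsurj x.1
      ((hψ x.1).1 x.2), D.isRepresentative_pureBlock x.1 ((hψ x.1).1 x.2)⟩, h5⟩, h6⟩
  -- A vector state of block i is the test state; equality of the two entropies gives m_i = 1 once
  -- p_i ≠ 0 is known.
  · have := (D.irreducible i).1
    obtain ⟨ψ, hψ⟩ := exists_norm_eq (K i) zero_le_one
    have hω := CStarEntropy.vectorState_mem_stateSpace (D.rep i) hψ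
    obtain ⟨_, hρ, p, hp, σ, hσ, rfl⟩ := D.exists_isRepresentative hπ hω
    refine (hvN _ p hp σ hσ hρ).2.2.1 (h _ hω _ hρ) i fun hpi => ?_
    -- On the element that is the identity of block i and zero elsewhere, the vector state takes the
    -- value 1, whereas p_i = 0 would make it 0.
    obtain ⟨a, ha⟩ := hsurj (Pi.single i 1)
    have h1 := (D.representedBy_of_isRepresentative hρ).apply_of_eq_single ha
    rw [CStarEntropy.vectorState_apply, ha, Pi.single_eq_same, one_apply_eq_self,
      inner_self_eq_norm_sq_to_K, hψ, hpi] at h1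
    simp [CStarEntropy.trace] at h1
  · obtain ⟨ρ', hρ', p, hp, σ, hσ, rfl⟩ := D.exists_isRepresentative hπ hω
    obtain rfl := hρ.unique hρ'
    exact (hvN ω p hp σ hσ hρ).2.2.2 fun i _ => h i
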